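/- Let $\mathbb F_q$ be a finite field with algebraic closure $k=\overline{\mathbb F}_q$, let $n\ge 1$, and let $\mathcal X\subset\mathbb P^n(k)$ be an irreducible projective curve defined over $\mathbb F_q$ and not contained in a hyperplane. For a nonsingular point $P\in\mathcal X$, the intersection multiplicities at $P$ of $\mathcal X$ with hyperplanes take exactly $n+1$ values $j_0(P)<\cdots<j_n(P)$ (the order sequence at $P$), and the osculating hyperplane $H_P$ is the unique hyperplane that meets $\mathcal X$ at $P$ with multiplicity $j_n(P)$. Let $(\varepsilon_0,\dots,\varepsilon_n)$ be the order sequence of $\mathcal X$, i.e. the common value of $(j_0(P),\dots,j_n(P))$ at all but finitely many $P\in\mathcal X$. The points where it is attained are called generic. The strict Gauss map $\gamma:\mathcal X\to\mathcal X'$ sends a generic point $P$ to $H_P$, regarded as a point of the dual projective space, and $\mathcal X'$ is the Zariski closure of its image there. The separable degree $\deg_s\gamma$ is the separable degree of the field extension $k(\mathcal X)/\gamma^*k(\mathcal X')$. Let $x_0,\dots,x_n\in\mathbb F_q(\mathcal X)$ be coordinate functions of $\mathcal X$ (so that $(x_0:\dots:x_n)$ is its generic point), let $t\in k(\mathcal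 X)$ be a separating element, and let $D_t^{(m)}$ denote the $m$-th Hasse derivative with respect to $t$. For $i\ge1$, the $\mathbb F_{q^i}$-Frobenius order sequence of $\mathcal X$ is the lexicographically least sequence $(\nu_0,\dots,\nu_{n-1})$ of non-negative integers such that the $(n+1)\times(n+1)$ determinant with rows $(x_0^{q^i},\dots,x_n^{q^i})$ and $(D_t^{(\nu_l)}x_0,\dots,D_t^{(\nu_l)}x_n)$, $0\le l\le n-1$, is nonzero; it does not depend on the choice of the $x_j$ and of $t$. The curve is $\mathbb F_{q^i}$-Frobenius nonclassical if this sequence differs from $(0,1,\dots,n-1)$. Suppose that for every $i=1,\dots,n-1$ the curve $\mathcal X$ is $\mathbb F_{q^i}$-Frobenius nonclassical and the last term $\nu_{n-1}$ of its $\mathbb F_{q^i}$-Frobenius order sequence equals $\varepsilon_n$. Then $\deg_s\gamma=1$, that is, the Gauss map $\gamma$ is purely inseparable (the extension $k(\mathcal X)/\gamma^*k(\mathcal X')$ is purely inseparable). -/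

import Mathlib

noncomputable section

open IntermediateField
open scoped PowerSeries LinearAlgebra.Projectivization

namespace ArakelianGauss

/-! ### Hasse derivatives with respect to a separating element -/

section Hasse

variable {k K : Type*} [Field k] [Field K] [Algebra k K]

/-- `t` is a separating element of `K / k`: it is transcendental and `K / k(t)` is separable
algebraic. -/
def IsSeparatingElement (k : Type*) {K : Type*} [Field k] [Field K] [Algebra k K] (t : K) : Prop :=
  Transcendental k t ∧ Algebra.IsSeparable k⟮t⟯ K

theorem exists_lift_ringHom {E A B : Type*} [Field E] [Field A] [CommRing B] [Algebra E A]
    [Algebra.IsSeparable E A] (e : E →+* B) (π : B →+* A) (hπ : Function.Surjective π)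
    (he : π.comp e = algebraMap E A) [IsAdicComplete (RingHom.ker π) B] :
    ∃ D : A →+* B, D.comp (algebraMap E A) = e ∧ π.comp D = RingHom.id A := by
  let _ := e.toAlgebra
  have : Algebra.FormallyEtale E A := Algebra.FormallyEtale.of_isSeparable E A
  let π' : B →ₐ[E] A := { π with commutes' := fun r => congr($he r) }
  let q : (B ⧸ RingHom.ker π) ≃ₐ[E] A := Ideal.quotientKerAlgEquivOfSurjective (f := π') hπ
  obtain ⟨g, hg⟩ := Algebra.FormallySmooth.exists_mkₐ_comp_eq_of_isAdicComplete
    (I := RingHom.ker π) (q.symm : A →ₐ[E] B ⧸ RingHom.ker π)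
  refine ⟨g, g.comp_algebraMap, ?_⟩
  ext x
  have h := congr(q ($hg x))
  simp only [AlgEquiv.coe_toAlgHom, AlgEquiv.apply_symm_apply] at h
  exact h

theorem lift_ringHom_unique {E A B : Type*} [Field E] [Field A] [CommRing B] [Algebra E A]
    [Algebra.IsSeparable E A] (e : E →+* B) (π : B →+* A) [IsAdicComplete (RingHom.ker π) B]
    {D₁ D₂ : A →+* B} (h₁ : D₁.comp (algebraMap E A) = e) (h₂ : D₂.comp (algebraMap E A) = e)
    (h : π.comp D₁ = π.comp D₂) : D₁ = D₂ := by
  let _ := e.toAlgebra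
  have : Algebra.FormallyEtale E A := Algebra.FormallyEtale.of_isSeparable E A
  let D₁' : A →ₐ[E] B := { D₁ with commutes' := fun r => congr($h₁ r) }
  let D₂' : A →ₐ[E] B := { D₂ with commutes' := fun r => congr($h₂ r) }
  have hinf : ⨅ i, RingHom.ker π ^ i = ⊥ := by
    rw [eq_bot_iff]
    intro x hx
    refine IsHausdorff.haus (I := RingHom.ker π) (M := B) inferInstance x fun m => ?_
    rw [SModEq.zero]
    simpa using (Ideal.mem_iInf.mp hx) m
  have hD : D₁' = D₂' := Algebra.FormallyUnramified.ext_of_iInf (RingHom.ker π) hinf fun x => by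
    rw [Ideal.Quotient.eq, RingHom.mem_ker, map_sub, sub_eq_zero]
    exact congr($h x)
  ext x
  exact congr($hD x)

/-- For a separating element `t` of `K / k` there is exactly one homomorphism of `k`-algebras
`f ↦ ∑ m, (D_t^(m) f) T ^ m` from `K` to `K⟦T⟧` with `D_t^(0) f = f` that sends `t` to `t + T`. -/
theorem existsUnique_taylor {t : K} (ht : IsSeparatingElement k t) :
    ∃! D : K →ₐ[k] K⟦X⟧, (∀ f, PowerSeries.constantCoeff (D f) = f) ∧
      D t = PowerSeries.C t + PowerSeries.X := by
  obtain ⟨htr, hsep⟩ := ht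
  have hker : RingHom.ker (PowerSeries.constantCoeff (R := K)) = Ideal.span {PowerSeries.X} := by
    ext f
    rw [RingHom.mem_ker, Ideal.mem_span_singleton, PowerSeries.X_dvd_iff]
  have : IsAdicComplete (RingHom.ker (PowerSeries.constantCoeff (R := K))) K⟦X⟧ := by
    rw [hker]
    infer_instance
  -- the embedding of `k(t)` into `K⟦T⟧` with `t ↦ t + T`
  let a : Polynomial k →ₐ[k] K⟦X⟧ := Polynomial.aeval (PowerSeries.C t + PowerSeries.X)
  have ha : ∀ p, PowerSeries.constantCoeff (a p) = Polynomial.aeval t p := by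
    intro p
    have h : ((PowerSeries.constantCoeff (R := K)).comp (a : Polynomial k →+* K⟦X⟧)) =
        (Polynomial.aeval t : Polynomial k →ₐ[k] K) := by
      ext x <;> simp [a, PowerSeries.algebraMap_apply]
    exact congr($h p)
  have hunit : ∀ p : nonZeroDivisors (Polynomial k), IsUnit ((a : Polynomial k →+* K⟦X⟧) p) := by
    intro p
    rw [PowerSeries.isUnit_iff_constantCoeff, isUnit_iff_ne_zero]
    intro h
    have h' : Polynomial.aeval t (p : Polynomial k) = 0 := by rw [← ha]; exact h
    exact nonZeroDivisors.ne_zero p.2 ((transcendental_iff.mp htr) _ h')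
  let e₀ : RatFunc k →+* K⟦X⟧ := IsLocalization.lift (M := nonZeroDivisors (Polynomial k)) hunit
  have he₀ : ∀ p, e₀ (algebraMap (Polynomial k) (RatFunc k) p) = a p :=
    fun p => IsLocalization.lift_eq hunit p
  let i₀ : RatFunc k ≃ₐ[k] k⟮t⟯ := RatFunc.algEquivOfTranscendental t htr
  have hi₀ : ∀ p, (i₀ (algebraMap (Polynomial k) (RatFunc k) p) : K) = Polynomial.aeval t p := by
    intro p
    simp only [i₀, RatFunc.algEquivOfTranscendental_algebraMap]
    exact (Polynomial.aeval_algebraMap_apply K (AdjoinSimple.gen k t) p).symm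
  let e : k⟮t⟯ →+* K⟦X⟧ := e₀.comp (i₀.symm : k⟮t⟯ →+* RatFunc k)
  have he : ∀ p, e (i₀ (algebraMap (Polynomial k) (RatFunc k) p)) = a p := by
    intro p
    simp [e, he₀]
  have hπe : (PowerSeries.constantCoeff (R := K)).comp e = algebraMap k⟮t⟯ K := by
    have h : ((PowerSeries.constantCoeff (R := K)).comp e).comp (i₀ : RatFunc k →+* k⟮t⟯) =
        (algebraMap k⟮t⟯ K).comp (i₀ : RatFunc k →+* k⟮t⟯) := by
      refine IsLocalization.ringHom_ext (nonZeroDivisors (Polynomial k)) (RingHom.ext fun p => ?_)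
      change PowerSeries.constantCoeff (e (i₀ _)) = (i₀ _ : K)
      rw [he, hi₀, ha]
    ext x
    obtain ⟨y, rfl⟩ := i₀.surjective x
    exact congr($h y)
  obtain ⟨D, hD, hD'⟩ := exists_lift_ringHom e (PowerSeries.constantCoeff (R := K))
    (fun x => ⟨PowerSeries.C x, by simp⟩) hπe
  have hDp : ∀ p : Polynomial k, D (Polynomial.aeval t p) = a p := by
    intro p
    rw [← he, ← hi₀, ← hD]
    rfl
  have hDk : ∀ r : k, D (algebraMap k K r) = algebraMap k K⟦X⟧ r := by
    intro r
    simpa [a] using hDp (Polynomial.C r)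
  have hDt : D t = PowerSeries.C t + PowerSeries.X := by
    simpa [a] using hDp Polynomial.X
  refine ⟨{ D with commutes' := hDk }, ⟨fun f => congr($hD' f), hDt⟩, ?_⟩
  rintro D₁ ⟨h₁, h₁t⟩
  -- uniqueness
  have hbase : ∀ x : k⟮t⟯, D₁ x = D x := by
    rintro ⟨x, hx⟩
    change D₁ x = D x
    induction hx using IntermediateField.adjoin_induction with
    | mem x hx => rw [Set.mem_singleton_iff.mp hx, h₁t, hDt]
    | algebraMap r => rw [hDk, D₁.commutes]
    | add x y _ _ hx hy => rw [map_add, map_add, hx, hy]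
    | mul x y _ _ hx hy => rw [map_mul, map_mul, hx, hy]
    | inv x _ hx =>
      rcases eq_or_ne x 0 with rfl | h0
      · simp
      · have h1 : D x * D₁ x⁻¹ = 1 := by rw [← hx, ← map_mul, mul_inv_cancel₀ h0, map_one]
        have h2 : D x * D x⁻¹ = 1 := by rw [← map_mul, mul_inv_cancel₀ h0, map_one]
        exact mul_left_cancel₀ (left_ne_zero_of_mul_eq_one h1) (h1.trans h2.symm)
  have huniq := lift_ringHom_unique (E := k⟮t⟯) e (PowerSeries.constantCoeff (R := K))
    (D₁ := (D₁ : K →+* K⟦X⟧)) (D₂ := D) ?_ hD ?_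
  · ext1 f
    exact congr($huniq f)
  · rw [← hD]
    ext1 x
    exact hbase x
  · rw [hD']
    ext1 f
    exact h₁ f

/-- The `m`-th Hasse derivative `D_t^(m) f` with respect to the separating element `t`. -/
def hasseDeriv {t : K} (ht : IsSeparatingElement k t) (m : ℕ) (f : K) : K :=
  PowerSeries.coeff m ((existsUnique_taylor ht).choose f)

end Hasse

/-! ### Projective curves -/

section Ideal

variable {k : Type*} [Field k] {n : ℕ}

/-- The coordinate `X_i` as an element of the field of fractions of the homogeneous coordinate
ring `k[X_0, …, X_n] / I`. -/
def coord (I : Ideal (MvPolynomial (Fin (n + 1)) k)) (i : Fin (n + 1)) :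
    FractionRing (MvPolynomial (Fin (n + 1)) k ⧸ I) :=
  algebraMap _ _ (Ideal.Quotient.mk I (MvPolynomial.X i))

/-- The function field of the projective variety with homogeneous prime ideal `I`, generated
over `k` by the ratios of the coordinates. -/
def functionField (I : Ideal (MvPolynomial (Fin (n + 1)) k)) [I.IsPrime] :
    IntermediateField k (FractionRing (MvPolynomial (Fin (n + 1)) k ⧸ I)) :=
  adjoin k {φ | ∃ i j, φ = coord I i / coord I j}

end Ideal

/-- An irreducible projective curve in `ℙⁿ(k)` (for `k` algebraically closed), given by its
homogeneous prime ideal. -/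
structure ProjectiveCurve (k : Type*) [Field k] (n : ℕ) where
  /-- the ideal of all polynomials vanishing on the curve -/
  ideal : Ideal (MvPolynomial (Fin (n + 1)) k)
  isPrime : ideal.IsPrime
  isHomogeneous : ∀ f ∈ ideal, ∀ d : ℕ, MvPolynomial.homogeneousComponent d f ∈ ideal
  dim_eq_one : Algebra.trdeg k (functionField ideal) = 1

attribute [instance] ProjectiveCurve.isPrime

namespace ProjectiveCurve

variable {k : Type*} [Field k] {n : ℕ} (X : ProjectiveCurve k n)

/-- The curve is defined over the subfield `F`: its ideal is generated by polynomials with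
coefficients in `F`. -/
def IsDefinedOver (F : Type*) [Field F] [Algebra F k] : Prop :=
  ∃ J : Ideal (MvPolynomial (Fin (n + 1)) F),
    X.ideal = J.map (MvPolynomial.map (algebraMap F k))

/-- The field of fractions of the homogeneous coordinate ring; it contains the function field. -/
abbrev ConeField : Type _ := FractionRing (MvPolynomial (Fin (n + 1)) k ⧸ X.ideal)

/-- The function field `k(X)`. -/
abbrev FunField : IntermediateField k X.ConeField := functionField X.ideal

/-- The function field `F(X)` over a subfield `F` of `k`. -/
def funFieldOver (F : Type*) [Field F] [Algebra F k] : IntermediateField F X.ConeField :=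
  adjoin F {φ | ∃ i j, φ = coord X.ideal i / coord X.ideal j}

/-- The class of a polynomial in the field of fractions of the homogeneous coordinate ring. -/
def toConeField : MvPolynomial (Fin (n + 1)) k →+* X.ConeField :=
  (algebraMap (MvPolynomial (Fin (n + 1)) k ⧸ X.ideal) X.ConeField).comp (Ideal.Quotient.mk X.ideal)

/-- The points of the curve. -/
def points : Set (ℙ k (Fin (n + 1) → k)) :=
  {P | ∀ f ∈ X.ideal, MvPolynomial.eval P.rep f = 0}

/-- `φ` is regular at `P` with value `c`: it is a quotient `f / g` of forms of the same degree with
`g(P) ≠ 0` and `c = f(P) / g(P)`. -/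
def HasValueAt (P : ℙ k (Fin (n + 1) → k)) (φ : X.ConeField) (c : k) : Prop :=
  ∃ (d : ℕ) (f g : MvPolynomial (Fin (n + 1)) k), f.IsHomogeneous d ∧ g.IsHomogeneous d ∧
    MvPolynomial.eval P.rep g ≠ 0 ∧ φ * X.toConeField g = X.toConeField f ∧
    c = MvPolynomial.eval P.rep f / MvPolynomial.eval P.rep g

/-- The local ring of the curve at `P`. -/
def localRing (P : ℙ k (Fin (n + 1) → k)) : Subring X.ConeField where
  carrier := {φ | ∃ c, X.HasValueAt P φ c}
  mul_mem' := by
    rintro a b ⟨_, d, f, g, hf, hg, h0, h, -⟩ ⟨_, d', f', g', hf', hg', h0', h', -⟩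
    refine ⟨_, d + d', f * f', g * g', hf.mul hf', hg.mul hg', by simp [h0, h0'], ?_, rfl⟩
    rw [map_mul, map_mul, ← h, ← h']
    ring
  one_mem' := ⟨_, 0, 1, 1, MvPolynomial.isHomogeneous_one _ _, MvPolynomial.isHomogeneous_one _ _,
    by simp, by simp, rfl⟩
  add_mem' := by
    rintro a b ⟨_, d, f, g, hf, hg, h0, h, -⟩ ⟨_, d', f', g', hf', hg', h0', h', -⟩
    refine ⟨_, d + d', f * g' + g * f', g * g', (hf.mul hg').add (hg.mul hf'), hg.mul hg',
      by simp [h0, h0'], ?_, rfl⟩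
    rw [map_mul, map_add, map_mul, map_mul, ← h, ← h']
    ring
  zero_mem' := ⟨_, 0, 0, 1, MvPolynomial.isHomogeneous_zero _ _ _,
    MvPolynomial.isHomogeneous_one _ _, by simp, by simp, rfl⟩
  neg_mem' := by
    rintro a ⟨_, d, f, g, hf, hg, h0, h, -⟩
    refine ⟨_, d, -f, g, hf.neg, hg, h0, ?_, rfl⟩
    rw [map_neg, ← h, neg_mul]

/-- `P` is a nonsingular point of the curve. -/
def IsNonsingularPoint (P : ℙ k (Fin (n + 1) → k)) : Prop :=
  P ∈ X.points ∧ IsDiscreteValuationRing (X.localRing P)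

/-- The intersection multiplicity at `P` of the curve and the hyperplane `∑ aᵢ Xᵢ = 0` is `m`,
where the hyperplane is the point `H = (a₀ : … : aₙ)` of the dual projective space. It is the
length of the local ring modulo a local equation `h = (∑ aᵢ Xᵢ) / (∑ bᵢ Xᵢ)` of the hyperplane,
where `∑ bᵢ Xᵢ` does not vanish at `P`. -/
def HasIntersectionMultiplicity (P H : ℙ k (Fin (n + 1) → k)) (m : ℕ) : Prop :=
  ∃ (b : Fin (n + 1) → k) (h : X.localRing P), ∑ i, b i * P.rep i ≠ 0 ∧
    (h : X.ConeField) * X.toConeField (∑ i, MvPolynomial.C (b i) * MvPolynomial.X i) =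
      X.toConeField (∑ i, MvPolynomial.C (H.rep i) * MvPolynomial.X i) ∧
    Ring.ord (X.localRing P) h = m

/-- `j₀ < … < jₙ` is the order sequence at the nonsingular point `P`: its terms are exactly the
intersection multiplicities at `P` of the curve with hyperplanes (not containing the curve). -/
def IsOrderSequenceAt (P : ℙ k (Fin (n + 1) → k)) (j : Fin (n + 1) → ℕ) : Prop :=
  X.IsNonsingularPoint P ∧ StrictMono j ∧
    Set.range j = {m | ∃ H, X.HasIntersectionMultiplicity P H m}

/-- `ε₀ < … < εₙ` is the order sequence of the curve: it is the order sequence at all but finitely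
many points. -/
def IsOrderSequence (ε : Fin (n + 1) → ℕ) : Prop :=
  {P | P ∈ X.points ∧ ¬ X.IsOrderSequenceAt P ε}.Finite

/-! ### Frobenius orders -/

/-- `x₀, …, xₙ ∈ F(X)` are coordinate functions of the curve, i.e. `(x₀ : … : xₙ)` is its generic
point. -/
def IsCoordinateFunctions (F : Type*) [Field F] [Algebra F k] (x : Fin (n + 1) → X.FunField) :
    Prop :=
  (∀ i, (x i : X.ConeField) ∈ X.funFieldOver F) ∧
    ∃ c : X.ConeField, c ≠ 0 ∧ ∀ i, (x i : X.ConeField) = c * coord X.ideal i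

/-- The matrix with rows `(x₀ ^ Q, …, xₙ ^ Q)` and `(D_t^(νᵢ) x₀, …, D_t^(νᵢ) xₙ)`. -/
def frobeniusMatrix {t : X.FunField} (ht : IsSeparatingElement k t) (x : Fin (n + 1) → X.FunField)
    (Q : ℕ) (ν : Fin n → ℕ) : Matrix (Fin (n + 1)) (Fin (n + 1)) X.FunField :=
  Matrix.of (Fin.cons (fun j => x j ^ Q) fun i j => hasseDeriv ht (ν i) (x j))

/-- For a curve defined over `F`, the sequence `ν₀, …, νₙ₋₁` is the `𝔽_Q`-Frobenius order
sequence: the lexicographically least one whose Frobenius matrix has nonzero determinant.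
(It does not depend on the coordinate functions and the separating element.) -/
def IsFrobeniusOrderSequence (F : Type*) [Field F] [Algebra F k] (Q : ℕ) (ν : Fin n → ℕ) : Prop :=
  ∃ (x : Fin (n + 1) → X.FunField) (t : X.FunField) (ht : IsSeparatingElement k t),
    X.IsCoordinateFunctions F x ∧
    IsLeast {μ : Lex (Fin n → ℕ) | (X.frobeniusMatrix ht x Q (ofLex μ)).det ≠ 0} (toLex ν)

/-! ### The strict Gauss map -/

/-- The generic points: nonsingular points whose order sequence is that of the curve. -/
def genericPoints : Set (ℙ k (Fin (n + 1) → k)) :=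
  {P | P ∈ X.points ∧ ∃ ε, X.IsOrderSequence ε ∧ X.IsOrderSequenceAt P ε}

/-- `H` is the osculating hyperplane at `P`: its intersection multiplicity with the curve at `P` is
the largest order at `P`. -/
def IsOsculatingHyperplane (P H : ℙ k (Fin (n + 1) → k)) : Prop :=
  ∃ j, X.IsOrderSequenceAt P j ∧ X.HasIntersectionMultiplicity P H (j (Fin.last n))

/-- The strict dual curve: the Zariski closure, in the dual projective space, of the set of
osculating hyperplanes at generic points. -/
def strictDual : Set (ℙ k (Fin (n + 1) → k)) :=
  {A | ∀ (d : ℕ) (G : MvPolynomial (Fin (n + 1)) k), G.IsHomogeneous d →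
    (∀ P ∈ X.genericPoints, ∀ H, X.IsOsculatingHyperplane P H → MvPolynomial.eval H.rep G = 0) →
    MvPolynomial.eval A.rep G = 0}

/-- `φ ∈ k(X)` is the pullback under the Gauss map `γ : P ↦ H_P` of a rational function `G₁ / G₂`
on the strict dual curve: `G₁`, `G₂` are forms of the same degree, `G₂` is not identically zero on
the strict dual, and `φ(P) = G₁(γ(P)) / G₂(γ(P))` for all but finitely many generic points `P` with
`G₂(γ(P)) ≠ 0`. -/
def IsGaussPullback (φ : X.FunField) : Prop :=
  ∃ (d : ℕ) (G₁ G₂ : MvPolynomial (Fin (n + 1)) k), G₁.IsHomogeneous d ∧ G₂.IsHomogeneous d ∧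
    (∃ A ∈ X.strictDual, MvPolynomial.eval A.rep G₂ ≠ 0) ∧
    {P | P ∈ X.genericPoints ∧ ∃ H, X.IsOsculatingHyperplane P H ∧
      MvPolynomial.eval H.rep G₂ ≠ 0 ∧
      ¬ X.HasValueAt P φ (MvPolynomial.eval H.rep G₁ / MvPolynomial.eval H.rep G₂)}.Finite

/-- The function field of the strict dual curve, as the subfield `γ^* k(X')` of `k(X)`. -/
def gaussField : IntermediateField k X.FunField :=
  adjoin k {φ | X.IsGaussPullback φ}

/-- The separable degree of the Gauss map. -/
def gaussSepDegree : ℕ := Field.finSepDegree X.gaussField X.FunField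

end ProjectiveCurve

end ArakelianGauss

end

noncomputable section

open IntermediateField Filter
open scoped PowerSeries LinearAlgebra.Projectivization

/-! Let `z` be the vector of coordinate functions, scaled so that one of them is `1`, let `K` be the
function field and `q` the order of `F`. Three steps prove the theorem.

Geometry: at almost every point `P` the hyperplane `H_P` contains `P` and its Frobenius images under
`q, ..., q^(n-1)`. It contains `P` because `εₙ > 0`. Its coefficients are, up to a factor, the only
solution of the equations given by the Hasse derivatives of order less than `εₙ`. When the last
Frobenius order is `εₙ`, lexicographic minimality makes the row `z^(q^i)` a combination of those
derivative rows, so `H_P` is orthogonal to it (`IsOrderSequence.eventually_frobenius`).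

The Gauss map: the curve is nondegenerate, so the `z_j` are `F`-independent and the `n` Moore rows
`z^(q^i)`, `i < n`, are `K`-independent (`linearIndependent_moore`). Hence they have a vector `w`
orthogonal to all of them, unique up to a factor. It represents the Gauss map, and with a suitable
normalization its entries lie in `gaussField`.

Inversion: apply Frobenius powers to `∑ w_j z_j^(q^i) = 0`. Then `z^(q^(n-1))` is orthogonal to
`w^(q^i)` for `i < n`. The entries of `w` are again `F`-independent, so these rows determine
`z^(q^(n-1))` up to a factor, with ratios in `k(w)` (`exists_frobenius_ratio_mem`). Thus a fixed
`p`-power of every ratio of coordinates lies in `gaussField`, and the extension is purely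
inseparable. -/

namespace ArakelianGauss

/-! ### Forms, and algebraic relations in transcendence degree one. -/

theorem aeval_mul_of_isHomogeneous {k A σ : Type*} [CommRing k] [CommRing A] [Algebra k A]
    {f : MvPolynomial σ k} {d : ℕ} (hf : f.IsHomogeneous d) (c : A) (v : σ → A) :
    MvPolynomial.aeval (fun i => c * v i) f = c ^ d * MvPolynomial.aeval v f := by
  simp only [MvPolynomial.aeval_def, MvPolynomial.eval₂_eq, Finset.mul_sum]
  refine Finset.sum_congr rfl fun m hm => ?_
  have hd : ∑ i ∈ m.support, m i = d := by
    have h := hf (MvPolynomial.mem_support_iff.mp hm)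
    rw [← h, Finsupp.weight_apply]
    simp [Finsupp.sum]
  rw [← hd, ← Finset.prod_pow_eq_pow_sum]
  simp only [mul_pow, Finset.prod_mul_distrib]
  ring

theorem eval_mul_of_isHomogeneous {k σ : Type*} [CommRing k]
    {f : MvPolynomial σ k} {d : ℕ} (hf : f.IsHomogeneous d) (c : k) (v : σ → k) :
    MvPolynomial.eval (fun i => c * v i) f = c ^ d * MvPolynomial.eval v f := by
  simpa [MvPolynomial.aeval_eq_eval] using aeval_mul_of_isHomogeneous hf c v

/-- If `z` is transcendental, then `u` is algebraic over `k[z]`. A relation for `u` with nonzero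
constant coefficient `b(z)` exhibits `b(z)` as a multiple of `u` in `k[z, u]`. -/
theorem exists_aeval_eq_mul_of_trdeg_eq_one {k K : Type*} [Field k] [Field K] [Algebra k K]
    (hK : Algebra.trdeg k K = 1) (z : K) {u : K} (hu : u ≠ 0) :
    ∃ b : Polynomial k, b ≠ 0 ∧ ∃ r ∈ Algebra.adjoin k {z, u}, Polynomial.aeval z b = u * r := by
  by_cases hz : IsAlgebraic k z
  · obtain ⟨b, hb, hb'⟩ := hz
    exact ⟨b, hb, 0, zero_mem _, by rw [hb', mul_zero]⟩
  have hind : AlgebraicIndependent k (fun _ : Unit => z) := by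
    rw [algebraicIndependent_unique_type_iff]
    exact hz
  have halg := (hind.isTranscendenceBasis_of_lift_trdeg_le_of_finite
    (by rw [hK]; simp)).isAlgebraic
  rw [Set.range_const] at halg
  obtain ⟨q, hq0, hq⟩ := (halg.isAlgebraic u).exists_nonzero_coeff_and_aeval_eq_zero
    (mem_nonZeroDivisors_of_ne_zero hu)
  obtain ⟨b, hb⟩ : ∃ b : Polynomial k, Polynomial.aeval z b = (q.coeff 0 : K) := by
    exact (Algebra.adjoin_singleton_eq_range_aeval k z).le (q.coeff 0).2
  refine ⟨b, ?_, -Polynomial.aeval u q.divX, neg_mem ?_, ?_⟩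
  · rintro rfl
    exact hq0 (Subtype.ext (by simpa using hb.symm))
  · rw [Polynomial.aeval_eq_sum_range]
    refine sum_mem fun i _ => ?_
    rw [Algebra.smul_def]
    refine mul_mem ?_ (pow_mem (Algebra.subset_adjoin (by simp)) i)
    exact Algebra.adjoin_mono (by simp) (q.divX.coeff i).2
  · rw [hb, mul_neg, eq_neg_iff_add_eq_zero, add_comm, ← hq]
    conv_rhs => rw [← Polynomial.divX_mul_X_add q]
    rw [map_add, map_mul, Polynomial.aeval_X, Polynomial.aeval_C, mul_comm]
    rfl

/-! ### Values of rational functions and finiteness of exceptional sets. -/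

namespace ProjectiveCurve

variable {k : Type*} [Field k] {n : ℕ} (X : ProjectiveCurve k n)

theorem toConeField_eq_aeval (f : MvPolynomial (Fin (n + 1)) k) :
    X.toConeField f = MvPolynomial.aeval (coord X.ideal) f := by
  have h : X.toConeField = (MvPolynomial.aeval (coord X.ideal) :
      MvPolynomial (Fin (n + 1)) k →ₐ[k] X.ConeField).toRingHom := by
    refine MvPolynomial.ringHom_ext (fun r => ?_) (fun i => ?_)
    · simp only [AlgHom.toRingHom_eq_coe, RingHom.coe_coe, MvPolynomial.aeval_C]
      rfl
    · simp only [AlgHom.toRingHom_eq_coe, RingHom.coe_coe, MvPolynomial.aeval_X]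
      rfl
  rw [h]
  rfl

theorem toConeField_eq_zero_iff {f : MvPolynomial (Fin (n + 1)) k} :
    X.toConeField f = 0 ↔ f ∈ X.ideal := by
  rw [toConeField, RingHom.comp_apply,
    map_eq_zero_iff _ (IsFractionRing.injective (MvPolynomial (Fin (n + 1)) k ⧸ X.ideal) _),
    Ideal.Quotient.eq_zero_iff_mem]

@[simp] theorem toConeField_X (i : Fin (n + 1)) :
    X.toConeField (MvPolynomial.X i) = coord X.ideal i := by
  simp [toConeField_eq_aeval]

@[simp] theorem toConeField_C (a : k) :
    X.toConeField (MvPolynomial.C a) = algebraMap k X.ConeField a := by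
  simp [toConeField_eq_aeval]

theorem toConeField_ne_zero_of_eval_ne_zero {P : ℙ k (Fin (n + 1) → k)} (hP : P ∈ X.points)
    {g : MvPolynomial (Fin (n + 1)) k} (hg : MvPolynomial.eval P.rep g ≠ 0) :
    X.toConeField g ≠ 0 :=
  fun h => hg (hP g (X.toConeField_eq_zero_iff.mp h))

theorem coord_ne_zero {P : ℙ k (Fin (n + 1) → k)} (hP : P ∈ X.points) {j : Fin (n + 1)}
    (hj : P.rep j ≠ 0) : coord X.ideal j ≠ 0 := by
  rw [← toConeField_X]
  exact X.toConeField_ne_zero_of_eval_ne_zero hP (by simpa using hj)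

variable {X}

namespace HasValueAt

variable {P : ℙ k (Fin (n + 1) → k)} {φ ψ : X.ConeField} {a b : k}

theorem unique (hP : P ∈ X.points) (ha : X.HasValueAt P φ a) (hb : X.HasValueAt P φ b) :
    a = b := by
  obtain ⟨d, f, g, hf, hg, h0, h, rfl⟩ := ha
  obtain ⟨d', f', g', hf', hg', h0', h', rfl⟩ := hb
  have hI : f * g' - f' * g ∈ X.ideal := by
    rw [← X.toConeField_eq_zero_iff, map_sub, map_mul, map_mul, ← h, ← h']
    ring
  have := hP _ hI
  rw [map_sub, map_mul, map_mul, sub_eq_zero] at this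
  rw [div_eq_div_iff h0 h0', this]

theorem algebraMap (c : k) : X.HasValueAt P (algebraMap k X.ConeField c) c :=
  ⟨0, MvPolynomial.C c, 1, MvPolynomial.isHomogeneous_C _ _, MvPolynomial.isHomogeneous_one _ _,
    by simp, by simp, by simp⟩

theorem zero : X.HasValueAt P 0 0 := by simpa using algebraMap (X := X) (P := P) 0

theorem one : X.HasValueAt P 1 1 := by simpa using algebraMap (X := X) (P := P) 1

theorem add (ha : X.HasValueAt P φ a) (hb : X.HasValueAt P ψ b) :
    X.HasValueAt P (φ + ψ) (a + b) := by
  obtain ⟨d, f, g, hf, hg, h0, h, rfl⟩ := ha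
  obtain ⟨d', f', g', hf', hg', h0', h', rfl⟩ := hb
  refine ⟨d + d', f * g' + g * f', g * g', (hf.mul hg').add (hg.mul hf'), hg.mul hg',
    by simp [h0, h0'], ?_, ?_⟩
  · rw [map_mul, map_add, map_mul, map_mul, ← h, ← h']
    ring
  · simp only [map_add, map_mul]
    field_simp

theorem mul (ha : X.HasValueAt P φ a) (hb : X.HasValueAt P ψ b) :
    X.HasValueAt P (φ * ψ) (a * b) := by
  obtain ⟨d, f, g, hf, hg, h0, h, rfl⟩ := ha
  obtain ⟨d', f', g', hf', hg', h0', h', rfl⟩ := hb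
  refine ⟨d + d', f * f', g * g', hf.mul hf', hg.mul hg', by simp [h0, h0'], ?_, ?_⟩
  · rw [map_mul, map_mul, ← h, ← h']
    ring
  · simp only [map_mul]
    field_simp

theorem neg (ha : X.HasValueAt P φ a) : X.HasValueAt P (-φ) (-a) := by
  simpa using (algebraMap (X := X) (P := P) (-1)).mul ha

theorem sub (ha : X.HasValueAt P φ a) (hb : X.HasValueAt P ψ b) :
    X.HasValueAt P (φ - ψ) (a - b) := by
  simpa [sub_eq_add_neg] using ha.add hb.neg

theorem pow (ha : X.HasValueAt P φ a) (m : ℕ) : X.HasValueAt P (φ ^ m) (a ^ m) := by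
  induction m with
  | zero => simpa using one
  | succ m ih => simpa [pow_succ] using ih.mul ha

theorem sum {ι : Type*} {s : Finset ι} {φ : ι → X.ConeField} {a : ι → k}
    (h : ∀ i ∈ s, X.HasValueAt P (φ i) (a i)) :
    X.HasValueAt P (∑ i ∈ s, φ i) (∑ i ∈ s, a i) := by
  classical
  induction s using Finset.induction_on with
  | empty => simpa using zero
  | insert i s hi ih =>
    rw [Finset.sum_insert hi, Finset.sum_insert hi]
    exact (h i (Finset.mem_insert_self i s)).add
      (ih fun j hj => h j (Finset.mem_insert_of_mem hj))

theorem ne_zero (hP : P ∈ X.points) (ha : X.HasValueAt P φ a) (h : a ≠ 0) : φ ≠ 0 := by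
  rintro rfl
  exact h (ha.unique hP zero)

theorem inv (hP : P ∈ X.points) (ha : X.HasValueAt P φ a) (h : a ≠ 0) :
    X.HasValueAt P φ⁻¹ a⁻¹ := by
  have hφ := ha.ne_zero hP h
  obtain ⟨d, f, g, hf, hg, h0, h', rfl⟩ := ha
  refine ⟨d, g, f, hg, hf, fun h1 => h (by simp [h1]), ?_, by simp⟩
  rw [← h', inv_mul_cancel_left₀ hφ]

theorem coord_div_coord (hP : P ∈ X.points) {j : Fin (n + 1)} (hj : P.rep j ≠ 0)
    (i : Fin (n + 1)) :
    X.HasValueAt P (coord X.ideal i / coord X.ideal j) (P.rep i / P.rep j) :=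
  ⟨1, MvPolynomial.X i, MvPolynomial.X j, MvPolynomial.isHomogeneous_X _ _,
    MvPolynomial.isHomogeneous_X _ _, by simpa using hj,
    by simp [div_mul_cancel₀ _ (X.coord_ne_zero hP hj)], by simp⟩

end HasValueAt

variable (X)

/-- The functions that are regular at `P`, as a subalgebra. -/
def regularAt (P : ℙ k (Fin (n + 1) → k)) : Subalgebra k X.ConeField where
  __ := X.localRing P
  algebraMap_mem' c := ⟨c, HasValueAt.algebraMap c⟩

theorem toConeField_eq_pow_mul {f : MvPolynomial (Fin (n + 1)) k} {d : ℕ}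
    (hf : f.IsHomogeneous d) {j : Fin (n + 1)} (hj : coord X.ideal j ≠ 0) :
    X.toConeField f = coord X.ideal j ^ d *
      MvPolynomial.aeval (fun i => coord X.ideal i / coord X.ideal j) f := by
  rw [toConeField_eq_aeval, ← aeval_mul_of_isHomogeneous hf]
  congr 2
  funext i
  rw [mul_div_cancel₀ _ hj]

theorem coord_div_coord_mem (i j : Fin (n + 1)) :
    coord X.ideal i / coord X.ideal j ∈ functionField X.ideal :=
  subset_adjoin _ _ ⟨i, j, rfl⟩

theorem aeval_coord_div_coord_mem (f : MvPolynomial (Fin (n + 1)) k) (j : Fin (n + 1)) :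
    MvPolynomial.aeval (fun i => coord X.ideal i / coord X.ideal j) f ∈ functionField X.ideal := by
  have h : (MvPolynomial.aeval (fun i => coord X.ideal i / coord X.ideal j) f : X.ConeField) =
      (MvPolynomial.aeval (fun i => (⟨_, X.coord_div_coord_mem i j⟩ : X.FunField)) f :
        X.FunField) := by
    change _ = (functionField X.ideal).val _
    rw [MvPolynomial.comp_aeval_apply]
    rfl
  rw [h]
  exact SetLike.coe_mem _

theorem HasValueAt.mem_functionField {P : ℙ k (Fin (n + 1) → k)} (hP : P ∈ X.points)
    {φ : X.ConeField} {c : k} (h : X.HasValueAt P φ c) : φ ∈ functionField X.ideal := by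
  obtain ⟨d, f, g, hf, hg, h0, h, -⟩ := h
  obtain ⟨j, hj⟩ := Function.ne_iff.mp P.rep_nonzero
  have hj' := X.coord_ne_zero hP hj
  have hg0 := X.toConeField_ne_zero_of_eval_ne_zero hP h0
  rw [X.toConeField_eq_pow_mul hg hj'] at h hg0
  rw [X.toConeField_eq_pow_mul hf hj', mul_left_comm] at h
  have h1 := mul_left_cancel₀ (pow_ne_zero d hj') h
  have h2 := right_ne_zero_of_mul hg0
  rw [← eq_div_iff h2] at h1
  rw [h1]
  exact div_mem (X.aeval_coord_div_coord_mem f j) (X.aeval_coord_div_coord_mem g j)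

theorem exists_forms {φ : X.ConeField} (hφ : φ ∈ functionField X.ideal) :
    ∃ (d : ℕ) (f g : MvPolynomial (Fin (n + 1)) k), f.IsHomogeneous d ∧ g.IsHomogeneous d ∧
      g ∉ X.ideal ∧ φ * X.toConeField g = X.toConeField f := by
  have h1 : (1 : MvPolynomial (Fin (n + 1)) k) ∉ X.ideal := fun h =>
    X.isPrime.ne_top ((Ideal.eq_top_iff_one _).mpr h)
  have hz : ∃ (d : ℕ) (f g : MvPolynomial (Fin (n + 1)) k), f.IsHomogeneous d ∧
      g.IsHomogeneous d ∧ g ∉ X.ideal ∧ (0 : X.ConeField) * X.toConeField g = X.toConeField f :=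
    ⟨0, 0, 1, MvPolynomial.isHomogeneous_zero _ _ _, MvPolynomial.isHomogeneous_one _ _, h1,
      by simp⟩
  induction hφ using IntermediateField.adjoin_induction with
  | mem φ hφ =>
    obtain ⟨i, j, rfl⟩ := hφ
    by_cases hj : coord X.ideal j = 0
    · rw [hj, div_zero]
      exact hz
    · exact ⟨1, MvPolynomial.X i, MvPolynomial.X j, MvPolynomial.isHomogeneous_X _ _,
        MvPolynomial.isHomogeneous_X _ _,
        fun h => hj (by rw [← toConeField_X]; exact X.toConeField_eq_zero_iff.mpr h),
        by simp [div_mul_cancel₀ _ hj]⟩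
  | algebraMap r =>
    exact ⟨0, MvPolynomial.C r, 1, MvPolynomial.isHomogeneous_C _ _,
      MvPolynomial.isHomogeneous_one _ _, h1, by simp⟩
  | add φ ψ _ _ hφ hψ =>
    obtain ⟨d, f, g, hf, hg, h0, h⟩ := hφ
    obtain ⟨d', f', g', hf', hg', h0', h'⟩ := hψ
    refine ⟨d + d', f * g' + g * f', g * g', (hf.mul hg').add (hg.mul hf'), hg.mul hg',
      fun hm => (X.isPrime.mem_or_mem hm).elim h0 h0', ?_⟩
    rw [map_mul, map_add, map_mul, map_mul, ← h, ← h']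
    ring
  | mul φ ψ _ _ hφ hψ =>
    obtain ⟨d, f, g, hf, hg, h0, h⟩ := hφ
    obtain ⟨d', f', g', hf', hg', h0', h'⟩ := hψ
    refine ⟨d + d', f * f', g * g', hf.mul hf', hg.mul hg',
      fun hm => (X.isPrime.mem_or_mem hm).elim h0 h0', ?_⟩
    rw [map_mul, map_mul, ← h, ← h']
    ring
  | inv φ _ hφ =>
    obtain ⟨d, f, g, hf, hg, h0, h⟩ := hφ
    rcases eq_or_ne φ 0 with rfl | h1
    · rw [inv_zero]
      exact hz
    · refine ⟨d, g, f, hg, hf, fun hm => ?_, by rw [← h, inv_mul_cancel_left₀ h1]⟩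
      rw [X.toConeField_eq_zero_iff.mpr hm] at h
      exact (mul_ne_zero h1 fun h => h0 (X.toConeField_eq_zero_iff.mp h)) h

/-- If `u` is a nonzero function, then the values of `z` at the common regular points where `u`
vanishes belong to a finite set. -/
theorem exists_polynomial_of_value_zero (z u : X.FunField) (hu : u ≠ 0) :
    ∃ b : Polynomial k, b ≠ 0 ∧ ∀ P ∈ X.points, ∀ c, X.HasValueAt P (z : X.ConeField) c →
      X.HasValueAt P (u : X.ConeField) 0 → b.eval c = 0 := by
  have haeval : ∀ (b : Polynomial k) (P : ℙ k (Fin (n + 1) → k)) (c : k),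
      X.HasValueAt P (z : X.ConeField) c →
      X.HasValueAt P ((Polynomial.aeval z b : X.FunField) : X.ConeField) (b.eval c) := by
    intro b P c h
    induction b using Polynomial.induction_on' with
    | add p q hp hq => simpa using hp.add hq
    | monomial m a =>
      simpa [Polynomial.aeval_monomial] using (HasValueAt.algebraMap a).mul (h.pow m)
  -- The cofactor `r` is a polynomial in `z` and `u`, so it is regular wherever both are; there
  -- `b(z) = u r` vanishes together with `u`.
  obtain ⟨b, hb, r, hr, h⟩ := exists_aeval_eq_mul_of_trdeg_eq_one X.dim_eq_one z hu
  refine ⟨b, hb, fun P hP c hc hu0 => ?_⟩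
  have hle : Algebra.adjoin k {z, u} ≤ (X.regularAt P).comap X.FunField.val := by
    refine Algebra.adjoin_le ?_
    rintro _ (rfl | rfl)
    exacts [⟨_, hc⟩, ⟨_, hu0⟩]
  obtain ⟨c', hc'⟩ := hle hr
  have h1 := haeval b P c hc
  rw [h] at h1
  simpa using h1.unique hP (hu0.mul hc')

/-- On the chart `X_j ≠ 0`, at the zeros of `g` each affine coordinate is a root of a fixed nonzero
polynomial, and the affine coordinates determine the point. -/
theorem finite_setOf_eval_eq_zero {g : MvPolynomial (Fin (n + 1)) k} {d : ℕ}
    (hg : g.IsHomogeneous d) (hgI : g ∉ X.ideal) :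
    {P | P ∈ X.points ∧ MvPolynomial.eval P.rep g = 0}.Finite := by
  have hsub : {P | P ∈ X.points ∧ MvPolynomial.eval P.rep g = 0} ⊆
      ⋃ j : Fin (n + 1), {P | P ∈ X.points ∧ MvPolynomial.eval P.rep g = 0 ∧ P.rep j ≠ 0} := by
    rintro P ⟨hP, h⟩
    obtain ⟨j, hj⟩ := Function.ne_iff.mp P.rep_nonzero
    exact Set.mem_iUnion.mpr ⟨j, hP, h, hj⟩
  refine (Set.finite_iUnion fun j => ?_).subset hsub
  by_cases hj : coord X.ideal j = 0
  · refine Set.finite_empty.subset ?_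
    rintro P ⟨hP, -, h⟩
    exact X.coord_ne_zero hP h hj
  let z : Fin (n + 1) → X.FunField := fun i => ⟨_, X.coord_div_coord_mem i j⟩
  let u : X.FunField := ⟨_, X.aeval_coord_div_coord_mem g j⟩
  have hgu := X.toConeField_eq_pow_mul hg hj
  have hu : u ≠ 0 := by
    intro h
    refine hgI (X.toConeField_eq_zero_iff.mp ?_)
    rw [hgu]
    exact mul_eq_zero_of_right _ (congrArg Subtype.val h)
  choose b hb0 hb using fun i => X.exists_polynomial_of_value_zero (z i) u hu
  refine Set.Finite.of_finite_image (f := fun P i => P.rep i / P.rep j)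
    ((Set.Finite.pi' (t := fun i => {c | (b i).IsRoot c}) fun i =>
      Polynomial.finite_setOfPred_isRoot (hb0 i)).subset ?_) ?_
  · rintro _ ⟨P, ⟨hP, h, hPj⟩, rfl⟩ i
    refine hb i P hP _ (HasValueAt.coord_div_coord hP hPj i) ?_
    refine ⟨d, g, MvPolynomial.X j ^ d, hg, by
      simpa using (MvPolynomial.isHomogeneous_X k j).pow d, by simp [hPj], ?_, by simp [h]⟩
    rw [hgu, map_pow, toConeField_X, mul_comm]
  · rintro P ⟨hP, -, hPj⟩ Q ⟨hQ, -, hQj⟩ h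
    rw [← P.mk_rep, ← Q.mk_rep, Projectivization.mk_eq_mk_iff']
    refine ⟨P.rep j / Q.rep j, funext fun i => ?_⟩
    have hi := congr_fun h i
    simp only [Pi.smul_apply, smul_eq_mul] at hi ⊢
    field_simp at hi ⊢
    linear_combination -hi

theorem finite_setOf_not_regular (φ : X.FunField) :
    {P | P ∈ X.points ∧ ¬ ∃ c, X.HasValueAt P (φ : X.ConeField) c}.Finite := by
  obtain ⟨d, f, g, hf, hg, hgI, h⟩ := X.exists_forms φ.2
  refine (X.finite_setOf_eval_eq_zero hg hgI).subset ?_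
  rintro P ⟨hP, hc⟩
  refine ⟨hP, ?_⟩
  by_contra h0
  exact hc ⟨_, d, f, g, hf, hg, h0, h, rfl⟩

theorem exists_transcendental_ratio :
    ∃ i j, coord X.ideal j ≠ 0 ∧
      Transcendental k (coord X.ideal i / coord X.ideal j : X.ConeField) := by
  by_contra! H
  have halg : ∀ i j, IsAlgebraic k (coord X.ideal i / coord X.ideal j : X.ConeField) := by
    intro i j
    by_cases hj : coord X.ideal j = 0
    · rw [hj, div_zero]
      exact isAlgebraic_zero
    · by_contra h
      exact H i j hj h
  have : Algebra.IsAlgebraic k (functionField X.ideal) := by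
    refine IntermediateField.isAlgebraic_adjoin fun φ hφ => ?_
    obtain ⟨i, j, rfl⟩ := hφ
    exact (halg i j).isIntegral
  have h0 : Algebra.trdeg k (functionField X.ideal) = 0 := trdeg_eq_zero_iff.mpr this
  rw [X.dim_eq_one] at h0
  exact one_ne_zero h0

theorem exists_rep_eq (v : Fin (n + 1) → k) (hv : v ≠ 0) :
    ∃ a : k, a ≠ 0 ∧ (Projectivization.mk k v hv).rep = fun i => a * v i := by
  obtain ⟨a, ha⟩ := Projectivization.exists_smul_eq_mk_rep k v hv
  exact ⟨a, a.ne_zero, ha.symm⟩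

theorem mk_mem_points {v : Fin (n + 1) → k} (hv : v ≠ 0)
    (h : ∀ f ∈ X.ideal, MvPolynomial.eval v f = 0) : Projectivization.mk k v hv ∈ X.points := by
  intro f hf
  obtain ⟨a, -, ha⟩ := exists_rep_eq v hv
  rw [ha, ← MvPolynomial.sum_homogeneousComponent f, map_sum]
  refine Finset.sum_eq_zero fun d _ => ?_
  rw [eval_mul_of_isHomogeneous (MvPolynomial.homogeneousComponent_isHomogeneous d f),
    h _ (X.isHomogeneous f hf d), mul_zero]

/-- If there were finitely many points, a transcendental ratio `X_i / X_j` would give a polynomial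
outside the ideal that vanishes on the whole cone, against the Nullstellensatz. -/
theorem infinite_points [IsAlgClosed k] : X.points.Infinite := by
  intro hfin
  obtain ⟨i, j, hj, hij⟩ := X.exists_transcendental_ratio
  classical
  let S := hfin.toFinset.filter fun P => P.rep j ≠ 0
  let h : MvPolynomial (Fin (n + 1)) k := MvPolynomial.X j *
    ∏ P ∈ S, (MvPolynomial.C (P.rep j) * MvPolynomial.X i -
      MvPolynomial.C (P.rep i) * MvPolynomial.X j)
  have hh : h ∉ X.ideal := by
    rw [← X.toConeField_eq_zero_iff, map_mul, map_prod, toConeField_X]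
    refine mul_ne_zero hj (Finset.prod_ne_zero_iff.mpr fun P hP h0 => hij ?_)
    have hPj : P.rep j ≠ 0 := (Finset.mem_filter.mp hP).2
    have hPj' : algebraMap k X.ConeField (P.rep j) ≠ 0 := by simpa using hPj
    simp only [map_sub, map_mul, toConeField_C, toConeField_X, sub_eq_zero] at h0
    have : (coord X.ideal i / coord X.ideal j : X.ConeField) =
        algebraMap k X.ConeField (P.rep i / P.rep j) := by
      rw [map_div₀, div_eq_div_iff hj hPj']
      linear_combination h0
    rw [this]
    exact isAlgebraic_algebraMap _
  rw [← MvPolynomial.IsPrime.vanishingIdeal_zeroLocus (K := k) X.ideal,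
    MvPolynomial.mem_vanishingIdeal_iff] at hh
  push Not at hh
  obtain ⟨v, hv, hv0⟩ := hh
  simp only [MvPolynomial.aeval_eq_eval] at hv0
  have hvI : ∀ f ∈ X.ideal, MvPolynomial.eval v f = 0 := by
    intro f hf
    simpa [MvPolynomial.aeval_eq_eval] using MvPolynomial.mem_zeroLocus_iff.mp hv f hf
  simp only [h, map_mul, MvPolynomial.eval_X, map_prod, map_sub, MvPolynomial.eval_C] at hv0
  have hvj : v j ≠ 0 := left_ne_zero_of_mul hv0
  have hvn : v ≠ 0 := fun h => hvj (by simp [h])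
  obtain ⟨a, ha0, ha⟩ := exists_rep_eq v hvn
  refine Finset.prod_ne_zero_iff.mp (right_ne_zero_of_mul hv0) (Projectivization.mk k v hvn)
    (Finset.mem_filter.mpr ⟨hfin.mem_toFinset.mpr (X.mk_mem_points hvn hvI), ?_⟩) ?_
  · rw [ha]
    exact mul_ne_zero ha0 hvj
  · rw [ha]
    ring

/-- The filter of all sets that contain all but finitely many points of the curve. -/
def almostAll : Filter (ℙ k (Fin (n + 1) → k)) := cofinite ⊓ 𝓟 X.points

theorem eventually_almostAll {p : ℙ k (Fin (n + 1) → k) → Prop} :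
    (∀ᶠ P in X.almostAll, p P) ↔ {P | P ∈ X.points ∧ ¬ p P}.Finite := by
  rw [almostAll, eventually_inf_principal, eventually_cofinite]
  simp only [Classical.not_imp]

/-- This turns a statement about almost all points into the existence of a point, so that identities
in the function field can be refuted by evaluation. -/
instance [IsAlgClosed k] : X.almostAll.NeBot := by
  rw [almostAll, inf_principal_neBot_iff]
  intro U hU
  by_contra h
  refine X.infinite_points ((mem_cofinite.mp hU).subset fun P hP hPU => h ⟨P, hPU, hP⟩)

theorem eventually_mem_points : ∀ᶠ P in X.almostAll, P ∈ X.points :=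
  mem_inf_of_right (mem_principal_self _)

theorem eventually_regular (φ : X.FunField) :
    ∀ᶠ P in X.almostAll, ∃ c, X.HasValueAt P (φ : X.ConeField) c :=
  X.eventually_almostAll.mpr (X.finite_setOf_not_regular φ)

theorem eventually_value_ne_zero {φ : X.FunField} (hφ : φ ≠ 0) :
    ∀ᶠ P in X.almostAll, ∃ c, c ≠ 0 ∧ X.HasValueAt P (φ : X.ConeField) c := by
  filter_upwards [X.eventually_mem_points, X.eventually_regular φ, X.eventually_regular φ⁻¹]
    with P hP ⟨c, hc⟩ ⟨c', hc'⟩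
  refine ⟨c, ?_, hc⟩
  rintro rfl
  have h := hc.mul hc'
  rw [← MulMemClass.coe_mul, mul_inv_cancel₀ hφ] at h
  simpa using h.unique hP HasValueAt.one

end ProjectiveCurve

/-! ### Taylor expansions and their values at points. -/

section Hasse

variable {k K : Type*} [Field k] [Field K] [Algebra k K] {t : K} (ht : IsSeparatingElement k t)

/-- The Taylor expansion `f ↦ ∑ m, (D_t^(m) f) T ^ m`. -/
def taylor : K →ₐ[k] K⟦X⟧ := (existsUnique_taylor ht).choose

theorem coeff_taylor (m : ℕ) (f : K) : PowerSeries.coeff m (taylor ht f) = hasseDeriv ht m f := rfl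

theorem constantCoeff_taylor (f : K) : PowerSeries.constantCoeff (taylor ht f) = f :=
  (existsUnique_taylor ht).choose_spec.1.1 f

theorem taylor_self : taylor ht t = PowerSeries.C t + PowerSeries.X :=
  (existsUnique_taylor ht).choose_spec.1.2

theorem hasseDeriv_zero (f : K) : hasseDeriv ht 0 f = f := by
  rw [← coeff_taylor, PowerSeries.coeff_zero_eq_constantCoeff_apply, constantCoeff_taylor]

theorem hasseDeriv_sum_algebraMap_mul {ι : Type*} (s : Finset ι) (m : ℕ) (a : ι → k) (f : ι → K) :
    hasseDeriv ht m (∑ i ∈ s, algebraMap k K (a i) * f i) =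
      ∑ i ∈ s, algebraMap k K (a i) * hasseDeriv ht m (f i) := by
  simp only [← coeff_taylor, map_sum, map_mul, AlgHom.commutes, PowerSeries.algebraMap_apply,
    PowerSeries.coeff_C_mul]

end Hasse

namespace ProjectiveCurve

variable {k : Type*} [Field k] {n : ℕ} (X : ProjectiveCurve k n)
  {t : X.FunField} (ht : IsSeparatingElement k t)

/-- The values at `P` of the Hasse derivatives of `φ` of order less than `M` exist, and they are
the coefficients of the power series `s`. -/
def HasTaylorAt (P : ℙ k (Fin (n + 1) → k)) (M : ℕ) (φ : X.FunField) (s : k⟦X⟧) : Prop :=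
  ∀ m < M, X.HasValueAt P ((hasseDeriv ht m φ : X.FunField) : X.ConeField) (PowerSeries.coeff m s)

namespace HasTaylorAt

variable {X ht} {P : ℙ k (Fin (n + 1) → k)} {M : ℕ} {φ ψ : X.FunField} {a b : k⟦X⟧}

theorem coeff_unique (hP : P ∈ X.points) (ha : X.HasTaylorAt ht P M φ a)
    (hb : X.HasTaylorAt ht P M φ b) {m : ℕ} (hm : m < M) :
    PowerSeries.coeff m a = PowerSeries.coeff m b :=
  (ha m hm).unique hP (hb m hm)

theorem add (ha : X.HasTaylorAt ht P M φ a) (hb : X.HasTaylorAt ht P M ψ b) :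
    X.HasTaylorAt ht P M (φ + ψ) (a + b) := by
  intro m hm
  rw [← coeff_taylor, map_add, map_add, map_add, AddMemClass.coe_add]
  exact (ha m hm).add (hb m hm)

theorem mul (ha : X.HasTaylorAt ht P M φ a) (hb : X.HasTaylorAt ht P M ψ b) :
    X.HasTaylorAt ht P M (φ * ψ) (a * b) := by
  intro m hm
  rw [← coeff_taylor, map_mul, PowerSeries.coeff_mul, PowerSeries.coeff_mul,
    AddSubmonoidClass.coe_finsetSum]
  refine HasValueAt.sum fun i hi => ?_
  have := Finset.HasAntidiagonal.mem_antidiagonal.mp hi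
  rw [MulMemClass.coe_mul]
  exact (ha i.1 (by omega)).mul (hb i.2 (by omega))

theorem algebraMap (c : k) :
    X.HasTaylorAt ht P M (algebraMap k X.FunField c) (PowerSeries.C c) := by
  intro m _
  rw [← coeff_taylor, AlgHom.commutes, PowerSeries.algebraMap_apply, PowerSeries.coeff_C,
    PowerSeries.coeff_C]
  split_ifs
  · exact HasValueAt.algebraMap c
  · exact HasValueAt.zero

theorem one : X.HasTaylorAt ht P M 1 1 := by
  simpa using algebraMap (X := X) (ht := ht) (P := P) (M := M) 1

theorem pow (ha : X.HasTaylorAt ht P M φ a) (m : ℕ) : X.HasTaylorAt ht P M (φ ^ m) (a ^ m) := by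
  induction m with
  | zero => simpa using one
  | succ m ih => simpa only [pow_succ] using ih.mul ha

theorem self {c : k} (hc : X.HasValueAt P (t : X.ConeField) c) :
    X.HasTaylorAt ht P M t (PowerSeries.C c + PowerSeries.X) := by
  intro m _
  rw [← coeff_taylor, taylor_self, map_add, map_add, PowerSeries.coeff_C, PowerSeries.coeff_X,
    PowerSeries.coeff_C, PowerSeries.coeff_X, AddMemClass.coe_add]
  refine HasValueAt.add ?_ ?_
  · split_ifs
    exacts [hc, HasValueAt.zero]
  · split_ifs
    exacts [HasValueAt.one, HasValueAt.zero]

theorem inv (hP : P ∈ X.points) (ha : X.HasTaylorAt ht P M φ a)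
    (h0 : PowerSeries.constantCoeff a ≠ 0) : X.HasTaylorAt ht P M φ⁻¹ a⁻¹ := by
  rcases Nat.eq_zero_or_pos M with rfl | hM
  · intro m hm
    omega
  have hc : X.HasValueAt P (φ : X.ConeField) (PowerSeries.constantCoeff a) := by
    simpa [hasseDeriv_zero] using ha 0 hM
  have hφ : φ ≠ 0 := by
    rintro rfl
    exact hc.ne_zero hP h0 rfl
  have htay : taylor ht φ⁻¹ = (taylor ht φ)⁻¹ := by
    rw [PowerSeries.eq_inv_iff_mul_eq_one (by rwa [constantCoeff_taylor]), ← map_mul,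
      inv_mul_cancel₀ hφ, map_one]
  intro m
  induction m using Nat.strong_induction_on with
  | _ m ih =>
    intro hm
    rw [← coeff_taylor, htay, PowerSeries.coeff_inv, PowerSeries.coeff_inv]
    have hc' : X.HasValueAt P ((φ⁻¹ : X.FunField) : X.ConeField)
        (PowerSeries.constantCoeff a)⁻¹ := hc.inv hP h0
    rw [constantCoeff_taylor]
    split_ifs with h
    · exact hc'
    · rw [MulMemClass.coe_mul, NegMemClass.coe_neg, AddSubmonoidClass.coe_finsetSum]
      refine hc'.neg.mul (HasValueAt.sum fun i hi => ?_)
      have := Finset.HasAntidiagonal.mem_antidiagonal.mp hi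
      split_ifs with hi2
      · rw [MulMemClass.coe_mul, ← htay]
        exact (ha i.1 (by omega)).mul (ih i.2 hi2 (by omega))
      · exact HasValueAt.zero

end HasTaylorAt

/-- For almost all `P`, the Hasse derivatives of order less than `M` of every function that is
regular at `P` are regular at `P`. -/
theorem eventually_exists_hasTaylorAt (M : ℕ) : ∀ᶠ P in X.almostAll, ∀ φ : X.FunField,
    (∃ c, X.HasValueAt P (φ : X.ConeField) c) → ∃ s, X.HasTaylorAt ht P M φ s := by
  let z : Fin (n + 1) → Fin (n + 1) → X.FunField := fun i j => ⟨_, X.coord_div_coord_mem i j⟩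
  -- Only the finitely many ratios of coordinates have to be controlled. Regularity then passes
  -- through polynomials and quotients, so the exceptional set does not depend on `φ`.
  have hz : ∀ᶠ P in X.almostAll, ∀ i j, ∀ m : Fin M, ∃ c,
      X.HasValueAt P ((hasseDeriv ht m (z i j) : X.FunField) : X.ConeField) c := by
    simp only [eventually_all]
    exact fun i j m => X.eventually_regular _
  filter_upwards [hz, X.eventually_mem_points] with P hPz hP
  rcases Nat.eq_zero_or_pos M with rfl | hM
  · exact fun φ _ => ⟨0, fun m hm => by omega⟩
  have hzT : ∀ i j, ∃ s, X.HasTaylorAt ht P M (z i j) s := by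
    intro i j
    choose c hc using hPz i j
    refine ⟨PowerSeries.mk fun m => if h : m < M then c ⟨m, h⟩ else 0, fun m hm => ?_⟩
    simpa [hm] using hc ⟨m, hm⟩
  obtain ⟨j, hj : P.rep j ≠ 0⟩ := Function.ne_iff.mp P.rep_nonzero
  have hj' := X.coord_ne_zero hP hj
  have hpoly : ∀ f : MvPolynomial (Fin (n + 1)) k, ∃ s,
      X.HasTaylorAt ht P M (MvPolynomial.aeval (fun i => z i j) f) s := by
    intro f
    induction f using MvPolynomial.induction_on with
    | C a => exact ⟨_, by rw [MvPolynomial.aeval_C]; exact HasTaylorAt.algebraMap a⟩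
    | add p q hp hq =>
      obtain ⟨s, hs⟩ := hp
      obtain ⟨s', hs'⟩ := hq
      exact ⟨_, by rw [map_add]; exact hs.add hs'⟩
    | mul_X p i hp =>
      obtain ⟨s, hs⟩ := hp
      obtain ⟨s', hs'⟩ := hzT i j
      exact ⟨_, by rw [map_mul, MvPolynomial.aeval_X]; exact hs.mul hs'⟩
  have hcoe : ∀ f : MvPolynomial (Fin (n + 1)) k,
      ((MvPolynomial.aeval (fun i => z i j) f : X.FunField) : X.ConeField) =
        MvPolynomial.aeval (fun i => coord X.ideal i / coord X.ideal j) f := by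
    intro f
    change X.FunField.val _ = _
    rw [MvPolynomial.comp_aeval_apply]
    rfl
  rintro φ ⟨-, d, f, g, hf, hg, h0, h, -⟩
  obtain ⟨s, hs⟩ := hpoly f
  obtain ⟨s', hs'⟩ := hpoly g
  have hg0 := X.toConeField_ne_zero_of_eval_ne_zero hP h0
  rw [X.toConeField_eq_pow_mul hg hj', ← hcoe] at h hg0
  rw [X.toConeField_eq_pow_mul hf hj', mul_left_comm, ← hcoe] at h
  have h1 := mul_left_cancel₀ (pow_ne_zero d hj') h
  have h2 := right_ne_zero_of_mul hg0
  have hval : X.HasValueAt P ((MvPolynomial.aeval (fun i => z i j) g : X.FunField) : X.ConeField)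
      (MvPolynomial.eval P.rep g / P.rep j ^ d) := by
    refine ⟨d, g, MvPolynomial.X j ^ d, hg, by
      simpa using (MvPolynomial.isHomogeneous_X k j).pow d, by simp [hj], ?_, by simp⟩
    rw [X.toConeField_eq_pow_mul hg hj', hcoe, map_pow, toConeField_X, mul_comm]
  have hs0 : PowerSeries.constantCoeff s' ≠ 0 := by
    have := hs' 0 hM
    rw [hasseDeriv_zero, PowerSeries.coeff_zero_eq_constantCoeff_apply] at this
    rw [this.unique hP hval]
    exact div_ne_zero h0 (pow_ne_zero _ hj)
  have hφ : φ = MvPolynomial.aeval (fun i => z i j) f *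
      (MvPolynomial.aeval (fun i => z i j) g)⁻¹ := by
    rw [← div_eq_mul_inv, eq_div_iff (fun h => h2 (by rw [h]; rfl))]
    exact Subtype.ext h1
  rw [hφ]
  exact ⟨_, hs.mul (hs'.inv hP hs0)⟩

end ProjectiveCurve

/-! ### Orders at a point and the characterization of the osculating hyperplane. -/

theorem pow_dvd_and_not_pow_dvd_of_ord_eq {R : Type*} [CommRing R] [IsDomain R]
    [IsDiscreteValuationRing R] {π h : R} (hπ : Irreducible π) {m : ℕ} (hm : Ring.ord R h = m) :
    π ^ m ∣ h ∧ ¬ π ^ (m + 1) ∣ h := by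
  have hpow : ∀ j : ℕ, Ring.ord R (π ^ j) = j := fun j => by
    rw [Ring.ord_pow (mem_nonZeroDivisors_of_ne_zero hπ.ne_zero), Ring.ord_of_irreducible hπ]
    simp
  have hnot : ¬ π ^ (m + 1) ∣ h := fun hd => by
    have h1 := Ring.ord_le_ord_of_dvd hd
    rw [hpow, hm, Nat.cast_le] at h1
    omega
  refine ⟨?_, hnot⟩
  have h0 : h ≠ 0 := by
    rintro rfl
    exact hnot (dvd_zero _)
  obtain ⟨b, hb⟩ := IsDiscreteValuationRing.associated_pow_irreducible h0 hπ
  have h1 := Ring.ord_eq_of_associated hb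
  rw [hm, hpow, Nat.cast_inj] at h1
  rw [h1]
  exact hb.symm.dvd

/-- The dimension drops strictly after each of the `n + 1` indices `ε l`, which uses up the whole
dimension `n + 1`. -/
theorem finrank_le_one_of_strict_chain {k V : Type*} [Field k] [AddCommGroup V] [Module k V]
    [FiniteDimensional k V] {n : ℕ} (hV : Module.finrank k V = n + 1) {U : ℕ → Submodule k V}
    (hU : Antitone U) {ε : Fin (n + 1) → ℕ} (hε : StrictMono ε) {v : Fin (n + 1) → V}
    (hmem : ∀ l, v l ∈ U (ε l)) (hnot : ∀ l, v l ∉ U (ε l + 1)) :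
    Module.finrank k (U (ε (Fin.last n))) ≤ 1 ∧ U (ε (Fin.last n) + 1) = ⊥ := by
  have hlt : ∀ l, Module.finrank k (U (ε l + 1)) < Module.finrank k (U (ε l)) := fun l =>
    Submodule.finrank_lt_finrank_of_lt
      (SetLike.lt_iff_le_and_exists.mpr ⟨hU (Nat.le_succ _), v l, hmem l, hnot l⟩)
  have hle : ∀ l : Fin (n + 1), Module.finrank k (U (ε l)) + l ≤ n + 1 := by
    intro l
    induction l using Fin.induction with
    | zero => simpa [hV] using (U (ε 0)).finrank_le
    | succ i ih =>
      have h1 := hlt i.castSucc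
      have h2 := Submodule.finrank_mono (hU (Nat.succ_le_of_lt (hε i.castSucc_lt_succ)))
      simp only [Fin.val_castSucc, Fin.val_succ, Nat.succ_eq_add_one] at *
      omega
  have h1 := hle (Fin.last n)
  have h2 := hlt (Fin.last n)
  rw [Fin.val_last] at h1
  refine ⟨by omega, Submodule.finrank_eq_zero.mp (by omega)⟩

theorem IsSeparatingElement.sub_ne_zero {k K : Type*} [Field k] [Field K] [Algebra k K] {t : K}
    (ht : IsSeparatingElement k t) (c : k) : t + algebraMap k K (-c) ≠ 0 := by
  intro h
  refine ht.1 ?_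
  rw [map_neg, ← sub_eq_add_neg, sub_eq_zero] at h
  rw [h]
  exact isAlgebraic_algebraMap c

/-- Here `X` is to be the expansion of `t - t(P)`, `f` that of a unit and `X * q` that of a local
parameter. The exponents `a = 0` and `a ≥ 2` contradict the coefficients in degrees 0 and 1, so
`f(0) q(0) = 1`. -/
theorem constantCoeff_ne_zero_of_coeff_eq {k : Type*} [Field k] {f q : k⟦X⟧} {a : ℕ}
    (hf : PowerSeries.constantCoeff f ≠ 0)
    (h₀ : PowerSeries.coeff 0 (PowerSeries.X : k⟦X⟧) =
      PowerSeries.coeff 0 (f * (PowerSeries.X * q) ^ a))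
    (h₁ : PowerSeries.coeff 1 (PowerSeries.X : k⟦X⟧) =
      PowerSeries.coeff 1 (f * (PowerSeries.X * q) ^ a)) :
    PowerSeries.constantCoeff q ≠ 0 := by
  rw [mul_pow, mul_left_comm] at h₀ h₁
  rw [PowerSeries.coeff_one_X] at h₁
  match a with
  | 0 =>
    simp only [pow_zero, one_mul, mul_one,
      PowerSeries.coeff_zero_eq_constantCoeff_apply] at h₀
    exact absurd (by simpa using h₀.symm) hf
  | 1 =>
    rw [pow_one, show (1 : ℕ) = 0 + 1 from rfl, PowerSeries.coeff_succ_X_mul] at h₁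
    intro h0
    simp [h0] at h₁
  | a + 2 =>
    rw [PowerSeries.coeff_X_pow_mul', if_neg (by omega)] at h₁
    exact absurd h₁ one_ne_zero

namespace ProjectiveCurve

variable {k : Type*} [Field k] {n : ℕ} {X : ProjectiveCurve k n}

/-- `x₀, …, xₙ` are homogeneous coordinates of the generic point of the curve. -/
def IsCoord (x : Fin (n + 1) → X.FunField) : Prop :=
  ∃ c : X.ConeField, c ≠ 0 ∧ ∀ i, (x i : X.ConeField) = c * coord X.ideal i

/-- The linear combination `∑ aⱼ xⱼ`. -/
def linComb (x : Fin (n + 1) → X.FunField) (a : Fin (n + 1) → k) : X.FunField :=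
  ∑ j, algebraMap k X.FunField (a j) * x j

theorem coe_linComb (x : Fin (n + 1) → X.FunField) (a : Fin (n + 1) → k) :
    (linComb x a : X.ConeField) = ∑ j, algebraMap k X.ConeField (a j) * x j := by
  rw [linComb, AddSubmonoidClass.coe_finsetSum]
  rfl

theorem hasseDeriv_linComb {t : X.FunField} (ht : IsSeparatingElement k t) (m : ℕ)
    (x : Fin (n + 1) → X.FunField) (a : Fin (n + 1) → k) :
    hasseDeriv ht m (linComb x a) = linComb (fun j => hasseDeriv ht m (x j)) a :=
  hasseDeriv_sum_algebraMap_mul ht _ m a x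

theorem HasValueAt.linComb {P : ℙ k (Fin (n + 1) → k)} {x : Fin (n + 1) → X.FunField}
    {v : Fin (n + 1) → k} (h : ∀ j, X.HasValueAt P (x j : X.ConeField) (v j))
    (a : Fin (n + 1) → k) :
    X.HasValueAt P (linComb x a : X.ConeField) (∑ j, a j * v j) := by
  rw [coe_linComb]
  exact HasValueAt.sum fun j _ => (HasValueAt.algebraMap (a j)).mul (h j)

theorem IsCoord.eventually_value {x : Fin (n + 1) → X.FunField} (hx : IsCoord x) :
    ∀ᶠ P in X.almostAll, ∃ s : k, s ≠ 0 ∧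
      ∀ i, X.HasValueAt P (x i : X.ConeField) (s * P.rep i) := by
  obtain ⟨c, hc, hxc⟩ := hx
  have h : ∀ᶠ P in X.almostAll, ∀ i, x i ≠ 0 →
      ∃ v, v ≠ 0 ∧ X.HasValueAt P (x i : X.ConeField) v := by
    simp only [eventually_all]
    exact fun i hi => X.eventually_value_ne_zero hi
  filter_upwards [h, X.eventually_mem_points] with P hPx hP
  obtain ⟨j, hj : P.rep j ≠ 0⟩ := Function.ne_iff.mp P.rep_nonzero
  have hj' := X.coord_ne_zero hP hj
  obtain ⟨v, hv, hvj⟩ := hPx j (fun h => mul_ne_zero hc hj' (by rw [← hxc, h]; rfl))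
  refine ⟨v / P.rep j, div_ne_zero hv hj, fun i => ?_⟩
  have h1 := hvj.mul (HasValueAt.coord_div_coord hP hj i)
  have h2 : (x j : X.ConeField) * (coord X.ideal i / coord X.ideal j) = x i := by
    rw [hxc, hxc]
    field_simp
  rw [h2] at h1
  convert h1 using 1
  ring

variable (X) in
/-- The hyperplanes whose equation `∑ aⱼ xⱼ` is divisible by `π ^ m` in the local ring at `P`. -/
def divisibleBy (x : Fin (n + 1) → X.FunField) (P : ℙ k (Fin (n + 1) → k)) (π : X.ConeField)
    (m : ℕ) : Submodule k (Fin (n + 1) → k) where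
  carrier := {a | ∃ r ∈ X.regularAt P, (linComb x a : X.ConeField) = r * π ^ m}
  zero_mem' := ⟨0, zero_mem _, by simp [coe_linComb]⟩
  add_mem' := by
    rintro a b ⟨r, hr, ha⟩ ⟨r', hr', hb⟩
    refine ⟨r + r', add_mem hr hr', ?_⟩
    rw [add_mul, ← ha, ← hb]
    simp [coe_linComb, add_mul, Finset.sum_add_distrib]
  smul_mem' := by
    rintro c a ⟨r, hr, ha⟩
    refine ⟨algebraMap k _ c * r, mul_mem ⟨c, HasValueAt.algebraMap c⟩ hr, ?_⟩
    rw [mul_assoc, ← ha]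
    simp [coe_linComb, Finset.mul_sum, mul_assoc]

theorem divisibleBy_antitone (x : Fin (n + 1) → X.FunField) {P : ℙ k (Fin (n + 1) → k)}
    {π : X.ConeField} (hπ : π ∈ X.regularAt P) : Antitone (X.divisibleBy x P π) := by
  rintro m m' hm a ⟨r, hr, ha⟩
  refine ⟨r * π ^ (m' - m), mul_mem hr (pow_mem hπ _), ?_⟩
  rw [ha, mul_assoc, ← pow_add, Nat.sub_add_cancel hm]

theorem isUnit_of_value_ne_zero {P : ℙ k (Fin (n + 1) → k)} (hP : P ∈ X.points)
    {r : X.localRing P} {c : k} (h : X.HasValueAt P (r : X.ConeField) c) (hc : c ≠ 0) :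
    IsUnit r := by
  refine IsUnit.of_mul_eq_one (⟨_, _, h.inv hP hc⟩ : X.localRing P) (Subtype.ext ?_)
  exact mul_inv_cancel₀ (h.ne_zero hP hc)

theorem value_ne_zero_of_isUnit {P : ℙ k (Fin (n + 1) → k)} (hP : P ∈ X.points)
    {r : X.localRing P} {c : k} (h : X.HasValueAt P (r : X.ConeField) c) (hr : IsUnit r) :
    c ≠ 0 := by
  rintro rfl
  obtain ⟨r', hr'⟩ := hr.exists_right_inv
  obtain ⟨c', hc'⟩ := r'.2
  have h1 := h.mul hc'
  rw [← MulMemClass.coe_mul, hr'] at h1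
  simpa using h1.unique hP HasValueAt.one

theorem value_irreducible {P : ℙ k (Fin (n + 1) → k)} (hP : P ∈ X.points)
    {π : X.localRing P} (hπ : Irreducible π) : X.HasValueAt P (π : X.ConeField) 0 := by
  obtain ⟨c, hc⟩ := π.2
  rcases eq_or_ne c 0 with rfl | h
  · exact hc
  · exact absurd (isUnit_of_value_ne_zero hP hc h) hπ.not_isUnit

theorem HasIntersectionMultiplicity.mem_divisibleBy {x : Fin (n + 1) → X.FunField}
    (hx : IsCoord x) {P H : ℙ k (Fin (n + 1) → k)} (hP : P ∈ X.points)
    [IsDiscreteValuationRing (X.localRing P)] {s : k} (hs : s ≠ 0)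
    (hxs : ∀ i, X.HasValueAt P (x i : X.ConeField) (s * P.rep i)) {π : X.localRing P}
    (hπ : Irreducible π) {m : ℕ} (h : X.HasIntersectionMultiplicity P H m) :
    H.rep ∈ X.divisibleBy x P π m ∧ H.rep ∉ X.divisibleBy x P π (m + 1) := by
  obtain ⟨b, h, hb, hh, hord⟩ := h
  obtain ⟨c, hc, hxc⟩ := hx
  have hlin : ∀ a : Fin (n + 1) → k, (linComb x a : X.ConeField) =
      c * X.toConeField (∑ i, MvPolynomial.C (a i) * MvPolynomial.X i) := by
    intro a
    rw [coe_linComb, map_sum, Finset.mul_sum]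
    refine Finset.sum_congr rfl fun i _ => ?_
    rw [hxc, map_mul, toConeField_C, toConeField_X]
    ring
  -- The factor `linComb x b` is a unit at `P`, so the local equation `h` and `linComb x H.rep` have
  -- the same order.
  have hH : (linComb x H.rep : X.ConeField) = h * linComb x b := by
    rw [hlin, hlin, ← hh]
    ring
  have hbv := HasValueAt.linComb hxs b
  have hb0 : ∑ j, b j * (s * P.rep j) ≠ 0 := by
    have : ∑ j, b j * (s * P.rep j) = s * ∑ j, b j * P.rep j := by
      rw [Finset.mul_sum]
      exact Finset.sum_congr rfl fun j _ => by ring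
    rw [this]
    exact mul_ne_zero hs hb
  obtain ⟨hd, hnd⟩ := pow_dvd_and_not_pow_dvd_of_ord_eq hπ hord
  constructor
  · obtain ⟨r, hr⟩ := hd
    refine ⟨r * linComb x b, mul_mem r.2 ⟨_, hbv⟩, ?_⟩
    rw [hH, hr]
    push_cast
    ring
  · rintro ⟨r, hr, hr'⟩
    refine hnd ⟨⟨r, hr⟩ * ⟨_, _, hbv.inv hP hb0⟩, Subtype.ext ?_⟩
    rw [hr', ← div_eq_iff (hbv.ne_zero hP hb0)] at hH
    push_cast
    rw [← hH]
    ring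

variable {t : X.FunField} {ht : IsSeparatingElement k t}

/-- Taylor expansion is multiplicative and the expansion of `π` at `P` has no constant term, so `X ^
m` divides that of `φ`. -/
theorem hasseDeriv_value_zero_of_dvd {P : ℙ k (Fin (n + 1) → k)} (hP : P ∈ X.points) {M : ℕ}
    (hT : ∀ φ : X.FunField, (∃ c, X.HasValueAt P (φ : X.ConeField) c) →
      ∃ s, X.HasTaylorAt ht P M φ s)
    {π r : X.ConeField} (hπ : X.HasValueAt P π 0) (hr : r ∈ X.regularAt P) {m : ℕ} (hm : m ≤ M)
    {φ : X.FunField} (hφ : (φ : X.ConeField) = r * π ^ m) {l : ℕ} (hl : l < m) :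
    X.HasValueAt P ((hasseDeriv ht l φ : X.FunField) : X.ConeField) 0 := by
  lift π to X.FunField using hπ.mem_functionField X hP
  obtain ⟨c, hc⟩ := hr
  lift r to X.FunField using hc.mem_functionField X hP
  obtain ⟨p, hp⟩ := hT π ⟨_, hπ⟩
  obtain ⟨s, hs⟩ := hT r ⟨_, hc⟩
  have hp0 : PowerSeries.X ∣ p := by
    rw [PowerSeries.X_dvd_iff]
    have h := hp 0 (by omega)
    rw [hasseDeriv_zero] at h
    simpa using h.unique hP hπ
  have h := (hs.mul (hp.pow m)) l (by omega)
  have hd : PowerSeries.X ^ m ∣ s * p ^ m := (pow_dvd_pow_of_dvd hp0 m).mul_left s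
  rw [PowerSeries.X_pow_dvd_iff.mp hd l hl] at h
  have hφ' : φ = r * π ^ m := Subtype.ext hφ
  rwa [hφ']

theorem hasTaylorAt_sub_value {P : ℙ k (Fin (n + 1) → k)} {M : ℕ} {c : k}
    (hc : X.HasValueAt P (t : X.ConeField) c) :
    X.HasTaylorAt ht P M (t + algebraMap k X.FunField (-c)) PowerSeries.X := by
  have hX : (PowerSeries.X : k⟦X⟧) = PowerSeries.C c + PowerSeries.X + PowerSeries.C (-c) := by
    rw [map_neg]
    ring
  rw [hX]
  exact (HasTaylorAt.self hc).add (HasTaylorAt.algebraMap (-c))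

/-- Every nonzero regular function is a unit times a power of a local parameter. -/
theorem exists_eq_unit_mul_pow {P : ℙ k (Fin (n + 1) → k)} (hP : P ∈ X.points)
    [IsDiscreteValuationRing (X.localRing P)] {π : X.localRing P} (hπ : Irreducible π)
    {p : X.FunField} (hp : (p : X.ConeField) = π) {ψ : X.FunField} (hψ : ψ ≠ 0)
    (hψP : ∃ c, X.HasValueAt P (ψ : X.ConeField) c) :
    ∃ (b : ℕ) (u : X.FunField) (c : k), X.HasValueAt P (u : X.ConeField) c ∧ c ≠ 0 ∧
      ψ = u * p ^ b := by
  have hψ' : (⟨ψ, hψP⟩ : X.localRing P) ≠ 0 := fun h =>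
    hψ (Subtype.ext (congrArg (fun r : X.localRing P => (r : X.ConeField)) h))
  obtain ⟨b, hb⟩ := IsDiscreteValuationRing.associated_pow_irreducible hψ' hπ
  obtain ⟨u, hu⟩ := hb.symm
  obtain ⟨c, hc⟩ := (u : X.localRing P).2
  refine ⟨b, ⟨_, hc.mem_functionField X hP⟩, c, hc, value_ne_zero_of_isUnit hP hc u.isUnit,
    Subtype.ext ?_⟩
  have h : (π : X.ConeField) ^ b * ((u : X.localRing P) : X.ConeField) = ψ :=
    congrArg Subtype.val hu
  rw [← h, ← hp, mul_comm]
  rfl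

theorem HasTaylorAt.constantCoeff_eq {P : ℙ k (Fin (n + 1) → k)} (hP : P ∈ X.points) {M : ℕ}
    (hM : 0 < M) {φ : X.FunField} {s : k⟦X⟧} (hs : X.HasTaylorAt ht P M φ s) {c : k}
    (hc : X.HasValueAt P (φ : X.ConeField) c) : PowerSeries.constantCoeff s = c := by
  have h := hs 0 hM
  rw [hasseDeriv_zero, PowerSeries.coeff_zero_eq_constantCoeff_apply] at h
  exact h.unique hP hc

/-- Write `φ = u π ^ b` with `u` a unit. If `b < m`, the `b`-th derivative has the nonzero value
`u(P) q'(0) ^ b`, where `X * q'` is the expansion of `π`. That `q'(0) ≠ 0` comes from expanding `t -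
t(P)` to first order, hence `2 ≤ M`. -/
theorem dvd_of_hasseDeriv_value_zero {P : ℙ k (Fin (n + 1) → k)} (hP : P ∈ X.points)
    [IsDiscreteValuationRing (X.localRing P)] {M : ℕ} (hM : 2 ≤ M)
    (hT : ∀ φ : X.FunField, (∃ c, X.HasValueAt P (φ : X.ConeField) c) →
      ∃ s, X.HasTaylorAt ht P M φ s)
    (htP : ∃ c, X.HasValueAt P (t : X.ConeField) c)
    {π : X.localRing P} (hπ : Irreducible π) {m : ℕ} (hm : m ≤ M) {φ : X.FunField}
    (hφ : ∃ c, X.HasValueAt P (φ : X.ConeField) c)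
    (h : ∀ l < m, X.HasValueAt P ((hasseDeriv ht l φ : X.FunField) : X.ConeField) 0) :
    ∃ r ∈ X.regularAt P, (φ : X.ConeField) = r * (π : X.ConeField) ^ m := by
  rcases eq_or_ne φ 0 with rfl | hφ0
  · exact ⟨0, zero_mem _, by simp⟩
  have hπ0 := value_irreducible hP hπ
  obtain ⟨p, hp⟩ : ∃ p : X.FunField, (p : X.ConeField) = π := ⟨⟨_, hπ0.mem_functionField X hP⟩, rfl⟩
  rw [← hp] at hπ0
  obtain ⟨b, u, c, hu, hc, hfac⟩ := exists_eq_unit_mul_pow hP hπ hp hφ0 hφ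
  by_cases hbm : m ≤ b
  · refine ⟨u * π ^ (b - m), mul_mem ⟨_, hu⟩ (pow_mem π.2 _), ?_⟩
    rw [mul_assoc, ← pow_add, Nat.sub_add_cancel hbm, ← hp, hfac]
    rfl
  exfalso
  obtain ⟨e, he⟩ := hT u ⟨_, hu⟩
  obtain ⟨q, hq⟩ := hT p ⟨_, hπ0⟩
  obtain ⟨q', rfl⟩ : PowerSeries.X ∣ q := by
    rw [PowerSeries.X_dvd_iff, hq.constantCoeff_eq hP (by omega) hπ0]
  have hq' : PowerSeries.constantCoeff q' ≠ 0 := by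
    obtain ⟨c₀, hc₀⟩ := htP
    have hτ : X.HasTaylorAt ht P M _ _ := hasTaylorAt_sub_value hc₀
    obtain ⟨a, w, d, hw, hd, hfac'⟩ := exists_eq_unit_mul_pow hP hπ hp (ht.sub_ne_zero c₀)
      ⟨_, hc₀.add (HasValueAt.algebraMap (-c₀))⟩
    obtain ⟨f, hf⟩ := hT w ⟨_, hw⟩
    rw [hfac'] at hτ
    have hcmp := hf.mul (hq.pow a)
    exact constantCoeff_ne_zero_of_coeff_eq (hf.constantCoeff_eq hP (by omega) hw ▸ hd)
      (hτ.coeff_unique hP hcmp (by omega)) (hτ.coeff_unique hP hcmp (by omega))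
  have hcmp := (he.mul (hq.pow b)) b (by omega)
  rw [← hfac] at hcmp
  have h0 := hcmp.unique hP (h b (by omega))
  rw [mul_pow, mul_left_comm, PowerSeries.coeff_X_pow_mul', if_pos le_rfl, Nat.sub_self,
    PowerSeries.coeff_zero_eq_constantCoeff_apply, map_mul, map_pow,
    he.constantCoeff_eq hP (by omega) hu] at h0
  exact mul_ne_zero hc (pow_ne_zero b hq') h0

theorem IsOrderSequence.eventually {ε : Fin (n + 1) → ℕ} (hε : X.IsOrderSequence ε) :
    ∀ᶠ P in X.almostAll, X.IsOrderSequenceAt P ε :=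
  X.eventually_almostAll.mpr hε

theorem IsOsculatingHyperplane.hasIntersectionMultiplicity {P H : ℙ k (Fin (n + 1) → k)}
    {ε : Fin (n + 1) → ℕ} (hε : X.IsOrderSequenceAt P ε) (hH : X.IsOsculatingHyperplane P H) :
    X.HasIntersectionMultiplicity P H (ε (Fin.last n)) := by
  obtain ⟨j, hj, hm⟩ := hH
  rwa [(hj.2.1.range_inj hε.2.1).mp (hj.2.2.trans hε.2.2.symm)] at hm

theorem IsOrderSequenceAt.exists_osculatingHyperplane {P : ℙ k (Fin (n + 1) → k)}
    {ε : Fin (n + 1) → ℕ} (hε : X.IsOrderSequenceAt P ε) :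
    ∃ H, X.IsOsculatingHyperplane P H := by
  obtain ⟨H, hH⟩ : ∃ H, X.HasIntersectionMultiplicity P H (ε (Fin.last n)) :=
    hε.2.2.le (Set.mem_range_self (Fin.last n))
  exact ⟨H, ε, hε, hH⟩

theorem IsOrderSequenceAt.divisibleBy_last {x : Fin (n + 1) → X.FunField}
    (hx : IsCoord x) {P : ℙ k (Fin (n + 1) → k)}
    {s : k} (hs : s ≠ 0) (hxs : ∀ i, X.HasValueAt P (x i : X.ConeField) (s * P.rep i))
    {ε : Fin (n + 1) → ℕ} (hε : X.IsOrderSequenceAt P ε)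
    {π : X.localRing P} (hπ : Irreducible π) :
    Module.finrank k (X.divisibleBy x P π (ε (Fin.last n))) ≤ 1 ∧
      X.divisibleBy x P π (ε (Fin.last n) + 1) = ⊥ := by
  obtain ⟨⟨hP, hdvr⟩, hmono, hrange⟩ := hε
  have hH : ∀ l, ∃ H, X.HasIntersectionMultiplicity P H (ε l) := fun l =>
    hrange.le (Set.mem_range_self l)
  choose H hH using hH
  have := fun l => (hH l).mem_divisibleBy hx hP hs hxs hπ
  exact finrank_le_one_of_strict_chain (v := fun l => (H l).rep) (by simp)
    (divisibleBy_antitone x π.2) hmono (fun l => (this l).1) (fun l => (this l).2)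

/-- Nondegeneracy is implicit in having `n + 1` orders: the zero function is divisible by every
power of `π`, while only `a = 0` gives divisibility beyond `εₙ`. -/
theorem IsOrderSequence.linComb_injective [IsAlgClosed k] {ε : Fin (n + 1) → ℕ}
    (hε : X.IsOrderSequence ε) {x : Fin (n + 1) → X.FunField} (hx : IsCoord x)
    {a : Fin (n + 1) → k} (ha : linComb x a = 0) : a = 0 := by
  obtain ⟨P, hPε, s, hs, hxs⟩ := (hε.eventually.and hx.eventually_value).exists
  have := hPε.1.2
  obtain ⟨π, hπ⟩ := IsDiscreteValuationRing.exists_irreducible (X.localRing P)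
  have h : a ∈ X.divisibleBy x P π (ε (Fin.last n) + 1) := ⟨0, zero_mem _, by simp [ha]⟩
  rwa [(hPε.divisibleBy_last hx hs hxs hπ).2, Submodule.mem_bot] at h

theorem IsOrderSequence.eventually_value_osculating_zero {ε : Fin (n + 1) → ℕ}
    (hε : X.IsOrderSequence ε) {x : Fin (n + 1) → X.FunField} (hx : IsCoord x) (hn : 0 < n) :
    ∀ᶠ P in X.almostAll, ∀ H, X.IsOsculatingHyperplane P H →
      X.HasValueAt P (linComb x H.rep : X.ConeField) 0 := by
  filter_upwards [hε.eventually, hx.eventually_value] with P hPε ⟨s, hs, hxs⟩ H hH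
  obtain ⟨⟨hP, hdvr⟩, hmono, -⟩ := id hPε
  obtain ⟨π, hπ⟩ := IsDiscreteValuationRing.exists_irreducible (X.localRing P)
  obtain ⟨r, ⟨c, hr⟩, h⟩ :=
    ((hH.hasIntersectionMultiplicity hPε).mem_divisibleBy hx hP hs hxs hπ).1
  have hpos : ε (Fin.last n) ≠ 0 := by
    have h0 := hmono (show (0 : Fin (n + 1)) < Fin.last n from Fin.lt_def.mpr (by simpa using hn))
    omega
  rw [h]
  simpa [hpos] using hr.mul ((value_irreducible hP hπ).pow (ε (Fin.last n)))

/-- At almost all points, the osculating hyperplane is the only one whose equation has vanishing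
Hasse derivatives of order less than the last order. -/
theorem IsOrderSequence.eventually_osculating {ε : Fin (n + 1) → ℕ}
    (hε : X.IsOrderSequence ε) {x : Fin (n + 1) → X.FunField} (hx : IsCoord x)
    (ht : IsSeparatingElement k t) :
    ∀ᶠ P in X.almostAll, ∀ H, X.IsOsculatingHyperplane P H →
      (∀ m < ε (Fin.last n), X.HasValueAt P
        ((linComb (fun j => hasseDeriv ht m (x j)) H.rep : X.FunField) : X.ConeField) 0) ∧
      ∀ a, (∀ m < ε (Fin.last n), X.HasValueAt P
        ((linComb (fun j => hasseDeriv ht m (x j)) a : X.FunField) : X.ConeField) 0) →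
          ∃ c : k, a = c • H.rep := by
  -- The summand `2` leaves room for the first-order comparison in `dvd_of_hasseDeriv_value_zero`
  -- even for small `εₙ`.
  filter_upwards [hε.eventually, hx.eventually_value, X.eventually_regular t,
    X.eventually_exists_hasTaylorAt ht (ε (Fin.last n) + 2)] with P hPε ⟨s, hs, hxs⟩ htP hT H hH
  obtain ⟨⟨hP, hdvr⟩, hmono, -⟩ := id hPε
  obtain ⟨π, hπ⟩ := IsDiscreteValuationRing.exists_irreducible (X.localRing P)
  have hHm := ((hH.hasIntersectionMultiplicity hPε).mem_divisibleBy hx hP hs hxs hπ).1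
  have hfr := (hPε.divisibleBy_last hx hs hxs hπ).1
  simp only [← hasseDeriv_linComb]
  constructor
  · obtain ⟨r, hr, h⟩ := hHm
    exact fun m hm => hasseDeriv_value_zero_of_dvd hP hT (value_irreducible hP hπ) hr
      (by omega) h hm
  · intro a ha
    have ham : a ∈ X.divisibleBy x P π (ε (Fin.last n)) :=
      dvd_of_hasseDeriv_value_zero hP (by omega) hT htP hπ (by omega)
        ⟨_, HasValueAt.linComb hxs a⟩ ha
    -- Vanishing derivatives amount to divisibility by `π ^ εₙ`, and the hyperplanes with this
    -- property form a space of dimension at most one.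
    obtain ⟨⟨v, hv⟩, hspan⟩ := finrank_le_one_iff.mp hfr
    obtain ⟨c₁, h₁⟩ := hspan ⟨_, hHm⟩
    obtain ⟨c₂, h₂⟩ := hspan ⟨_, ham⟩
    replace h₁ : c₁ • v = H.rep := congrArg Subtype.val h₁
    replace h₂ : c₂ • v = a := congrArg Subtype.val h₂
    have hc₁ : c₁ ≠ 0 := by
      rintro rfl
      exact H.rep_nonzero (by rw [← h₁, zero_smul])
    refine ⟨c₂ * c₁⁻¹, ?_⟩
    rw [← h₁, smul_smul, inv_mul_cancel_right₀ hc₁, h₂]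

end ProjectiveCurve

/-! ### Lexicographic minimality and the Frobenius images on the osculating hyperplane. -/

section LinearAlgebra

variable {K : Type*} [Field K]

/-- If `V` and the `a`-th basis vector did not span everything, the coefficients of a nonzero
functional killing both would contradict `h`. -/
theorem le_finrank_add_one_of_orthogonal {N : ℕ} (V : Submodule K (Fin N → K)) (a : Fin N)
    (h : ∀ y : Fin N → K, (∀ v ∈ V, ∑ j, y j * v j = 0) → y a = 0 → y = 0) :
    N ≤ Module.finrank K V + 1 := by
  have htop : V ⊔ K ∙ (Pi.single a 1 : Fin N → K) = ⊤ := by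
    by_contra hne
    obtain ⟨f, hf, hle⟩ := Submodule.exists_le_ker_of_lt_top _ (lt_top_iff_ne_top.mpr hne)
    have hfv : ∀ v : Fin N → K, f v = ∑ j, f (Pi.single j 1) * v j := by
      intro v
      conv_lhs => rw [pi_eq_sum_univ' v]
      simp [map_sum, mul_comm]
    have hy := h (fun j => f (Pi.single j 1))
      (fun v hv => by rw [← hfv]; exact hle (Submodule.mem_sup_left hv))
      (hle (Submodule.mem_sup_right (Submodule.mem_span_singleton_self _)))
    refine hf (LinearMap.ext fun v => ?_)
    rw [hfv]
    simp [fun j => congr_fun hy j]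
  have h1 := Submodule.finrank_add_le_finrank_add_finrank V (K ∙ (Pi.single a 1 : Fin N → K))
  rw [htop, finrank_top, Module.finrank_fin_fun] at h1
  refine h1.trans (Nat.add_le_add_left ?_ _)
  simpa using finrank_span_le_card (R := K) ({Pi.single a 1} : Set (Fin N → K))

/-- Among the rows `D m`, let those with the lexicographically least indices `ν` complete `y` to a
basis. If the rows `D m` with `m` less than the last index span at least a hyperplane, then `y` is
a linear combination of them. -/
theorem exists_eq_sum_of_isLeast_det_ne_zero {n : ℕ} {D : ℕ → Fin (n + 2) → K} {y : Fin (n + 2) → K}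
    {ν : Fin (n + 1) → ℕ}
    (hν : IsLeast {μ : Lex (Fin (n + 1) → ℕ) |
      (Matrix.of (Fin.cons y fun i => D (ofLex μ i) :
        Fin (n + 2) → Fin (n + 2) → K)).det ≠ 0} (toLex ν))
    (hV : ∃ a, ∀ u : Fin (n + 2) → K, (∀ m < ν (Fin.last n), ∑ j, u j * D m j = 0) → u a = 0 →
      u = 0) :
    ∃ c : Fin (ν (Fin.last n)) → K, ∀ j, ∑ m, c m * D m j = y j := by
  obtain ⟨a, ha⟩ := hV
  have hfr := le_finrank_add_one_of_orthogonal
    (Submodule.span K (Set.range fun m : Fin (ν (Fin.last n)) => D m)) a fun u hu hua =>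
      ha u (fun m hm => hu _ (Submodule.subset_span ⟨⟨m, hm⟩, rfl⟩)) hua
  have hdet : ∀ r : Fin (n + 2) → Fin (n + 2) → K,
      (Matrix.of r).det ≠ 0 ↔ LinearIndependent K r := by
    intro r
    rw [← isUnit_iff_ne_zero, ← Matrix.isUnit_iff_isUnit_det,
      ← Matrix.linearIndependent_rows_iff_isUnit]
    rfl
  let rows : Fin (n + 1) → Fin (n + 2) → K := Fin.cons y fun i => D (Fin.init ν i)
  have hrows : ∀ m, (Fin.cons y fun i => D ((Fin.snoc (Fin.init ν) m : Fin (n + 1) → ℕ) i) :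
      Fin (n + 2) → Fin (n + 2) → K) = Fin.snoc rows (D m) := by
    intro m
    have h := Fin.comp_snoc (n := n) D (Fin.init ν) m
    simp only [Function.comp_def] at h
    rw [h, Fin.cons_snoc_eq_snoc_cons]
  have hmem : ∀ m, LinearIndependent K (Fin.snoc rows (D m) : Fin (n + 2) → Fin (n + 2) → K) ↔
      LinearIndependent K rows ∧ D m ∉ Submodule.span K (Set.range rows) := fun m =>
    linearIndependent_finSnoc
  have h0 := hν.1
  simp only [Set.mem_ofPred_eq, ofLex_toLex, hdet] at h0
  rw [← Fin.snoc_init_self ν, hrows, hmem] at h0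
  have hle : Submodule.span K (Set.range fun m : Fin (ν (Fin.last n)) => D m) ≤
      Submodule.span K (Set.range rows) := by
    rw [Submodule.span_le]
    rintro _ ⟨m, rfl⟩
    -- Otherwise replacing the last index by the smaller `m` keeps the determinant nonzero, against
    -- minimality.
    by_contra hm
    have h1 : toLex (Fin.snoc (Fin.init ν) m : Fin (n + 1) → ℕ) ∈
        {μ : Lex (Fin (n + 1) → ℕ) | (Matrix.of (Fin.cons y fun i => D (ofLex μ i) :
        Fin (n + 2) → Fin (n + 2) → K)).det ≠ 0} := by
      simp only [Set.mem_ofPred_eq, ofLex_toLex, hdet]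
      rw [hrows, hmem]
      exact ⟨h0.1, hm⟩
    refine (hν.2 h1).not_gt ⟨Fin.last n, fun j hj => ?_, ?_⟩
    · obtain ⟨j, rfl⟩ := Fin.exists_castSucc_eq.mpr hj.ne
      simp [Fin.init]
    · simp
  -- The larger span has dimension `n + 1` and the smaller one at least that, so `y`, the first of
  -- `rows`, lies in the span of the derivatives.
  have heq := Submodule.eq_of_le_of_finrank_le hle (by
    rw [finrank_span_eq_card h0.1, Fintype.card_fin]
    omega)
  have hy : y ∈ Submodule.span K (Set.range fun m : Fin (ν (Fin.last n)) => D m) := by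
    rw [heq]
    exact Submodule.subset_span ⟨0, by simp [rows]⟩
  obtain ⟨c, hc⟩ := Submodule.mem_span_range_iff_exists_fun K |>.mp hy
  exact ⟨c, fun j => by simpa using congr_fun hc j⟩

end LinearAlgebra

namespace ProjectiveCurve

variable {k : Type*} [Field k] [IsAlgClosed k] {n : ℕ}

/-- Uniqueness of the osculating hyperplane carries over to `K`. A counterexample `y a` for each `a`
would specialize at a good point to a nonzero multiple of `H.rep` with vanishing `a`-th entry,
forcing `H.rep = 0`. -/
theorem IsOrderSequence.exists_coordinate_hasseDeriv {X : ProjectiveCurve k n}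
    {ε : Fin (n + 1) → ℕ} (hε : X.IsOrderSequence ε) {x : Fin (n + 1) → X.FunField}
    (hx : IsCoord x) {t : X.FunField} (ht : IsSeparatingElement k t) :
    ∃ a, ∀ y : Fin (n + 1) → X.FunField,
      (∀ m < ε (Fin.last n), ∑ j, y j * hasseDeriv ht m (x j) = 0) → y a = 0 → y = 0 := by
  by_contra! H
  choose y hy hya hy0 using H
  choose b hb using fun a => Function.ne_iff.mp (hy0 a)
  have h1 : ∀ᶠ P in X.almostAll, ∀ a j, ∃ c, X.HasValueAt P (y a j : X.ConeField) c := by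
    simp only [eventually_all]
    exact fun a j => X.eventually_regular _
  have h2 : ∀ᶠ P in X.almostAll, ∀ a, ∃ c, c ≠ 0 ∧ X.HasValueAt P (y a (b a) : X.ConeField) c := by
    simp only [eventually_all]
    exact fun a => X.eventually_value_ne_zero (hb a)
  have h3 : ∀ᶠ P in X.almostAll, ∀ (m : Fin (ε (Fin.last n))) j, ∃ c,
      X.HasValueAt P ((hasseDeriv ht m (x j) : X.FunField) : X.ConeField) c := by
    simp only [eventually_all]
    exact fun m j => X.eventually_regular _
  obtain ⟨P, hP, hPε, h1, h2, h3, hosc⟩ := (X.eventually_mem_points.and (hε.eventually.and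
    (h1.and (h2.and (h3.and (hε.eventually_osculating hx ht)))))).exists
  choose Y hY using h1
  choose v hv using h3
  obtain ⟨H, hH⟩ := hPε.exists_osculatingHyperplane
  refine H.rep_nonzero (funext fun a => ?_)
  obtain ⟨c, hc⟩ := (hosc H hH).2 (Y a) fun m hm => by
    have hval := HasValueAt.linComb (hv ⟨m, hm⟩) (Y a)
    have h0 : X.HasValueAt P ((∑ j, y a j * hasseDeriv ht m (x j) : X.FunField) : X.ConeField)
        (∑ j, Y a j * v ⟨m, hm⟩ j) := by
      rw [AddSubmonoidClass.coe_finsetSum]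
      exact HasValueAt.sum fun j _ => (hY a j).mul (hv ⟨m, hm⟩ j)
    rw [hy a m hm] at h0
    rwa [h0.unique hP HasValueAt.zero] at hval
  have hYa : Y a a = 0 := by
    have := hY a a
    rw [hya] at this
    exact this.unique hP HasValueAt.zero
  have hYb : Y a (b a) ≠ 0 := by
    obtain ⟨c', hc', hval⟩ := h2 a
    rwa [(hY a (b a)).unique hP hval]
  have hc0 : c ≠ 0 := by
    rintro rfl
    exact hYb (by simp [hc])
  have := congr_fun hc a
  rw [hYa] at this
  simpa [hc0] using this.symm

/-- If the last Frobenius order is the last order of the curve, then at almost all points the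
osculating hyperplane contains the Frobenius image of the point. -/
theorem IsOrderSequence.eventually_frobenius {X : ProjectiveCurve k (n + 1)}
    {ε : Fin (n + 2) → ℕ} (hε : X.IsOrderSequence ε) {x : Fin (n + 2) → X.FunField}
    (hx : IsCoord x) {t : X.FunField} (ht : IsSeparatingElement k t) {Q : ℕ}
    {ν : Fin (n + 1) → ℕ}
    (hν : IsLeast {μ : Lex (Fin (n + 1) → ℕ) | (X.frobeniusMatrix ht x Q (ofLex μ)).det ≠ 0}
      (toLex ν)) (hlast : ν (Fin.last n) = ε (Fin.last (n + 1))) :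
    ∀ᶠ P in X.almostAll, ∀ H, X.IsOsculatingHyperplane P H →
      X.HasValueAt P (linComb (fun j => x j ^ Q) H.rep : X.ConeField) 0 := by
  have hfr := hε.exists_coordinate_hasseDeriv hx ht
  rw [← hlast] at hfr
  have hmem := exists_eq_sum_of_isLeast_det_ne_zero (D := fun m j => hasseDeriv ht m (x j)) hν hfr
  obtain ⟨a, ha⟩ := hmem
  have h1 : ∀ᶠ P in X.almostAll, ∀ m, ∃ c, X.HasValueAt P (a m : X.ConeField) c := by
    simp only [eventually_all]
    exact fun m => X.eventually_regular _
  filter_upwards [h1, hε.eventually_osculating hx ht] with P hPa hosc H hH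
  choose α hα using hPa
  -- The Frobenius row is a `K`-combination of derivatives of order less than `εₙ`, and each of
  -- these is orthogonal to `H` at `P`.
  have heq : linComb (fun j => x j ^ Q) H.rep =
      ∑ m, a m * linComb (fun j => hasseDeriv ht m (x j)) H.rep := by
    simp only [linComb, Finset.mul_sum]
    rw [Finset.sum_comm]
    refine Finset.sum_congr rfl fun j _ => ?_
    rw [← ha j, Finset.mul_sum]
    exact Finset.sum_congr rfl fun m _ => by ring
  rw [heq, AddSubmonoidClass.coe_finsetSum]
  have := HasValueAt.sum (s := Finset.univ) fun m _ =>
    (hα m).mul ((hosc H hH).1 m (hlast ▸ m.2))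
  simpa using this

end ProjectiveCurve

/-! ### Orthogonal vectors, additive polynomials and Moore matrices. -/

section LinearAlgebra

variable {K : Type*} [Field K]

/-- For `n` independent vectors `rᵢ` of `Kⁿ⁺¹` and a suitable `j₀`, the standard basis vectors are
congruent to multiples `wⱼ` of the `j₀`-th one modulo the span of the `rᵢ`, and `w` is orthogonal
to all `rᵢ`. -/
theorem exists_orthogonal_of_linearIndependent {n : ℕ} {r : Fin n → Fin (n + 1) → K}
    (hr : LinearIndependent K r) :
    ∃ (j₀ : Fin (n + 1)) (w : Fin (n + 1) → K),
      (∀ j, ∃ a : Fin n → K, ∀ l, (Pi.single j 1 : Fin (n + 1) → K) l -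
        w j * (Pi.single j₀ 1 : Fin (n + 1) → K) l = ∑ i, a i * r i l) ∧
      ∀ i, ∑ j, w j * r i j = 0 := by
  let R := Submodule.span K (Set.range r)
  have hR : Module.finrank K R = n := by simpa using finrank_span_eq_card hr
  obtain ⟨j₀, hj₀⟩ : ∃ j₀, (Pi.single j₀ 1 : Fin (n + 1) → K) ∉ R := by
    by_contra! h
    have htop : R = ⊤ := by
      rw [eq_top_iff, ← (Pi.basisFun K (Fin (n + 1))).span_eq, Submodule.span_le]
      rintro _ ⟨j, rfl⟩
      simpa using h j
    rw [htop, finrank_top, Module.finrank_fin_fun] at hR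
    omega
  have hsup : R ⊔ K ∙ (Pi.single j₀ 1 : Fin (n + 1) → K) = ⊤ := by
    refine Submodule.eq_top_of_finrank_eq ?_
    have hlt : R < R ⊔ K ∙ (Pi.single j₀ 1 : Fin (n + 1) → K) :=
      SetLike.lt_iff_le_and_exists.mpr ⟨le_sup_left, _,
        Submodule.mem_sup_right (Submodule.mem_span_singleton_self _), hj₀⟩
    have h1 := Submodule.finrank_lt_finrank_of_lt hlt
    have h2 := (R ⊔ K ∙ (Pi.single j₀ 1 : Fin (n + 1) → K)).finrank_le
    rw [Module.finrank_fin_fun] at h2 ⊢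
    omega
  have hw : ∀ j, ∃ c : K, (Pi.single j 1 : Fin (n + 1) → K) - c • Pi.single j₀ 1 ∈ R := by
    intro j
    obtain ⟨ρ, hρ, _, hσ, h⟩ := Submodule.mem_sup.mp
      (hsup.ge (Submodule.mem_top : (Pi.single j 1 : Fin (n + 1) → K) ∈ ⊤))
    obtain ⟨c, rfl⟩ := Submodule.mem_span_singleton.mp hσ
    exact ⟨c, by rwa [← h, add_sub_cancel_right]⟩
  choose w hw using hw
  refine ⟨j₀, w, fun j => ?_, fun i => ?_⟩
  · obtain ⟨a, ha⟩ := (Submodule.mem_span_range_iff_exists_fun K).mp (hw j)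
    exact ⟨a, fun l => by simpa using (congr_fun ha l).symm⟩
  -- Expanding `r i` in the standard basis gives `r i ≡ (∑ w_j r_ij) e_{j₀}` modulo `R`. A nonzero
  -- coefficient would put `e_{j₀}` into `R`.
  · by_contra h0
    refine hj₀ ?_
    have h1 : ∑ j, r i j • ((Pi.single j 1 : Fin (n + 1) → K) - w j • Pi.single j₀ 1) ∈ R :=
      sum_mem fun j _ => R.smul_mem _ (hw j)
    have h2 : ∑ j, r i j • ((Pi.single j 1 : Fin (n + 1) → K) - w j • Pi.single j₀ 1) =
        r i - (∑ j, w j * r i j) • Pi.single j₀ 1 := by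
      simp only [smul_sub, Finset.sum_sub_distrib, smul_smul, ← Finset.sum_smul]
      congr 1
      · exact (pi_eq_sum_univ' (r i)).symm
      · simp only [mul_comm]
    rw [h2] at h1
    have h3 := R.sub_mem (Submodule.subset_span ⟨i, rfl⟩ : r i ∈ R) h1
    rw [sub_sub_cancel] at h3
    exact (R.smul_mem_iff h0).mp h3

/-- If `s` is orthogonal to every `r i`, this gives `s j = w * s j₀`. It serves both for the
osculating hyperplane and for the Frobenius power of `z`. -/
theorem eq_mul_of_orthogonal {K : Type*} [CommRing K] {n : ℕ} {r : Fin n → Fin (n + 1) → K}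
    {j j₀ : Fin (n + 1)} {w : K} {a : Fin n → K}
    (h : ∀ l, (Pi.single j 1 : Fin (n + 1) → K) l - w * (Pi.single j₀ 1 : Fin (n + 1) → K) l =
      ∑ i, a i * r i l) (s : Fin (n + 1) → K) :
    s j - w * s j₀ = ∑ i, a i * ∑ l, s l * r i l := by
  calc s j - w * s j₀ = ∑ l, s l * ((Pi.single j 1 : Fin (n + 1) → K) l -
        w * (Pi.single j₀ 1 : Fin (n + 1) → K) l) := by
        simp only [mul_sub, Finset.sum_sub_distrib, mul_left_comm _ w, ← Finset.mul_sum]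
        simp [Pi.single_apply]
    _ = ∑ i, a i * ∑ l, s l * r i l := by
        simp only [h, Finset.mul_sum]
        rw [Finset.sum_comm]
        exact Finset.sum_congr rfl fun i _ => Finset.sum_congr rfl fun l _ => by ring

end LinearAlgebra

section Moore

variable {F K : Type*} [Field F] [Finite F] [Field K] [Algebra F K]

variable (F K) in
/-- The `i`-th power `s ↦ s ^ (q ^ i)` of the Frobenius map, as a linear map over the field `F` with
`q` elements. -/
def frobeniusPow (i : ℕ) : K →ₗ[F] K :=
  letI := Fintype.ofFinite F
  (FiniteField.frobeniusAlgHom F K).toLinearMap ^ i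

theorem frobeniusPow_apply (i : ℕ) (s : K) : frobeniusPow F K i s = s ^ Nat.card F ^ i := by
  let _ := Fintype.ofFinite F
  rw [frobeniusPow]
  induction i with
  | zero => simp
  | succ i ih =>
    rw [pow_succ', Module.End.mul_apply, ih]
    simp [Nat.card_eq_fintype_card, pow_succ, pow_mul]

variable (F) in
/-- The additive polynomial `s ↦ ∑ aᵢ s ^ (q ^ i)`. -/
def additivePoly {m : ℕ} (a : Fin m → K) : K →ₗ[F] K :=
  ∑ i, LinearMap.mulLeft F (a i) ∘ₗ frobeniusPow F K i

theorem additivePoly_apply {m : ℕ} (a : Fin m → K) (s : K) :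
    additivePoly F a s = ∑ i, a i * s ^ Nat.card F ^ (i : ℕ) := by
  simp [additivePoly, frobeniusPow_apply]

/-- For `m > 0`, a polynomial of degree at most `q ^ (m - 1)` with at least `q ^ m` roots is zero.
-/
theorem eq_zero_of_le_ker_additivePoly {m : ℕ} {a : Fin m → K} {S : Submodule F K}
    [FiniteDimensional F S] (hS : S ≤ LinearMap.ker (additivePoly F a))
    (hm : m ≤ Module.finrank F S) : a = 0 := by
  let _ := Fintype.ofFinite F
  have : Finite S := Module.finite_of_finite F
  let _ := Fintype.ofFinite S
  have hq : 1 < Nat.card F := Finite.one_lt_card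
  let A : Polynomial K := ∑ i, Polynomial.C (a i) * Polynomial.X ^ Nat.card F ^ (i : ℕ)
  have hA : A = 0 := by
    rcases Nat.eq_zero_or_pos m with rfl | hm0
    · simp [A]
    refine Polynomial.eq_zero_of_natDegree_lt_card_of_eval_eq_zero A
      (f := fun s : S => (s : K)) Subtype.val_injective (fun s => ?_) ?_
    · have := hS s.2
      rw [LinearMap.mem_ker, additivePoly_apply] at this
      simpa [A, Polynomial.eval_finsetSum] using this
    · have hcard : Fintype.card S = Nat.card F ^ Module.finrank F S := by
        rw [Nat.card_eq_fintype_card, Module.card_eq_pow_finrank (K := F)]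
      have hdeg : A.natDegree ≤ Nat.card F ^ (m - 1) := by
        refine Polynomial.natDegree_sum_le_of_forall_le _ _ fun i _ => ?_
        exact (Polynomial.natDegree_C_mul_X_pow_le _ _).trans
          (Nat.pow_le_pow_right hq.le (by omega))
      rw [hcard]
      exact hdeg.trans_lt (Nat.pow_lt_pow_right hq (by omega))
  funext i
  have hcoeff : A.coeff (Nat.card F ^ (i : ℕ)) = a i := by
    simp only [A, Polynomial.finsetSum_coeff, Polynomial.coeff_C_mul_X_pow]
    rw [Finset.sum_eq_single i]
    · simp
    · intro j _ hj
      rw [if_neg]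
      exact fun h => hj (Fin.ext (Nat.pow_right_injective hq h).symm)
    · simp
  rw [← hcoeff, hA]
  simp

/-- A `K`-relation among the `n` rows is an additive polynomial vanishing on the `(n +
1)`-dimensional `F`-span of `z`. -/
theorem linearIndependent_moore {n : ℕ} {z : Fin (n + 1) → K} (hz : LinearIndependent F z) :
    LinearIndependent K fun (i : Fin n) j => z j ^ Nat.card F ^ (i : ℕ) := by
  have := FiniteDimensional.span_of_finite F (Set.finite_range z)
  rw [Fintype.linearIndependent_iff]
  intro a ha
  refine congr_fun (eq_zero_of_le_ker_additivePoly (F := F) (a := a)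
    (S := Submodule.span F (Set.range z)) ?_ ?_)
  · rw [Submodule.span_le]
    rintro _ ⟨j, rfl⟩
    rw [SetLike.mem_coe, LinearMap.mem_ker, additivePoly_apply]
    simpa using congr_fun ha j
  · rw [finrank_span_eq_card hz]
    simp

/-- On the `(n + 1)`-dimensional span of `z` the image lies in the line `F`, so the kernel has
dimension at least `n`. This is too large for a nonzero additive polynomial with `n` coefficients.
-/
theorem eq_zero_of_additivePoly_eq_algebraMap {n : ℕ} {z : Fin (n + 1) → K}
    (hz : LinearIndependent F z) {a : Fin n → K} {c : Fin (n + 1) → F}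
    (h : ∀ j, additivePoly F a (z j) = algebraMap F K (c j)) : c = 0 := by
  let S := Submodule.span F (Set.range z)
  have : FiniteDimensional F S := FiniteDimensional.span_of_finite F (Set.finite_range z)
  let A := (additivePoly F a).domRestrict S
  have hrange : LinearMap.range A ≤ LinearMap.range (Algebra.linearMap F K) := by
    rintro _ ⟨⟨s, hs⟩, rfl⟩
    change additivePoly F a s ∈ _
    have hle : S ≤ (LinearMap.range (Algebra.linearMap F K)).comap (additivePoly F a) := by
      rw [Submodule.span_le]
      rintro _ ⟨j, rfl⟩
      exact ⟨c j, (h j).symm⟩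
    exact hle hs
  have h1 : Module.finrank F (LinearMap.range A) ≤ 1 := by
    refine (Submodule.finrank_mono hrange).trans ?_
    simpa using LinearMap.finrank_range_le (Algebra.linearMap F K)
  have h2 := A.finrank_range_add_finrank_ker
  have h3 : Module.finrank F S = n + 1 := by simpa using finrank_span_eq_card hz
  have ha : a = 0 := by
    refine eq_zero_of_le_ker_additivePoly (F := F) (S := (LinearMap.ker A).map S.subtype) ?_ ?_
    · rintro _ ⟨s, hs, rfl⟩
      exact hs
    · rw [Submodule.finrank_map_subtype_eq]
      omega
  funext j
  have := h j
  rw [ha, additivePoly_apply] at this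
  simpa using this.symm

/-- If `z` and `w` are `F`-independent vectors with `w` orthogonal to the Frobenius powers of `z`,
then a Frobenius power of `z` is determined by `w` up to a factor. -/
theorem exists_frobenius_ratio_mem {k : Type*} [Field k] [Algebra k K] [Algebra F k]
    [IsScalarTower F k K] (L : IntermediateField k K) {n : ℕ} {z : Fin (n + 1) → K}
    (hz : LinearIndependent F z) {w : Fin (n + 1) → L} {j₀ : Fin (n + 1)}
    (hw : ∀ j, ∃ a : Fin n → K, ∀ l, (Pi.single j 1 : Fin (n + 1) → K) l -
        w j * (Pi.single j₀ 1 : Fin (n + 1) → K) l =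
          ∑ i, a i * z l ^ Nat.card F ^ (i : ℕ))
    (hwz : ∀ i : Fin n, ∑ j, (w j : K) * z j ^ Nat.card F ^ (i : ℕ) = 0) :
    ∃ j₁, z j₁ ≠ 0 ∧ ∀ j, (z j / z j₁) ^ Nat.card F ^ (n - 1) ∈ L := by
  choose a ha using hw
  -- Combining the congruences in `hw` with the coefficients of a relation `∑ c_j w_j = 0` removes
  -- `e_{j₀}` and leaves an additive polynomial sending each `z l` to `c l` in `F`.
  have hwF : LinearIndependent F w := by
    rw [Fintype.linearIndependent_iff]
    intro c hc
    refine congr_fun (eq_zero_of_additivePoly_eq_algebraMap hz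
      (a := fun i => ∑ j, algebraMap F K (c j) * a j i) fun l => ?_)
    have hc' : ∑ j, algebraMap F K (c j) * (w j : K) = 0 := by
      rw [← ZeroMemClass.coe_zero L, ← hc, AddSubmonoidClass.coe_finsetSum]
      refine Finset.sum_congr rfl fun j _ => ?_
      rw [← Algebra.smul_def]
      rfl
    rw [additivePoly_apply]
    calc ∑ i, (∑ j, algebraMap F K (c j) * a j i) * z l ^ Nat.card F ^ (i : ℕ)
        = ∑ j, algebraMap F K (c j) * ∑ i, a j i * z l ^ Nat.card F ^ (i : ℕ) := by
          simp only [Finset.sum_mul, Finset.mul_sum, mul_assoc]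
          exact Finset.sum_comm
      _ = algebraMap F K (c l) := by
          simp only [← ha, mul_sub, Finset.sum_sub_distrib, ← mul_assoc, ← Finset.sum_mul, hc']
          simp [Pi.single_apply]
  -- The Moore rows of `w` are taken over `L`, so the ratios `u` they produce lie in `L`.
  obtain ⟨j₁, u, hu, -⟩ := exists_orthogonal_of_linearIndependent (linearIndependent_moore hwF)
  have horth : ∀ i : Fin n, ∑ l, z l ^ Nat.card F ^ (n - 1) *
      (w l : K) ^ Nat.card F ^ (i : ℕ) = 0 := by
    intro i
    -- Raising orthogonality to `z^(q^(n-1-i))` to the power `q^i` brings every exponent of `z` to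
    -- `q^(n-1)`.
    have h := congrArg (frobeniusPow F K i) (hwz ⟨n - 1 - i, by omega⟩)
    rw [map_zero, map_sum] at h
    rw [← h]
    refine Finset.sum_congr rfl fun l _ => ?_
    rw [frobeniusPow_apply, mul_pow, ← pow_mul, ← pow_add, mul_comm,
      Nat.sub_add_cancel (by omega)]
  have hsingle : ∀ j l, L.val ((Pi.single j 1 : Fin (n + 1) → L) l) =
      (Pi.single j 1 : Fin (n + 1) → K) l := by
    intro j l
    rw [Pi.single_apply, Pi.single_apply]
    split_ifs <;> simp
  have hprop : ∀ j, z j ^ Nat.card F ^ (n - 1) = (u j : K) * z j₁ ^ Nat.card F ^ (n - 1) := by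
    intro j
    obtain ⟨b, hb⟩ := hu j
    have h1 := eq_mul_of_orthogonal (K := K) (r := fun i l => (w l : K) ^ Nat.card F ^ (i : ℕ))
      (j := j) (j₀ := j₁) (w := (u j : K)) (a := fun i => (b i : K)) (fun l => by
        have h := congrArg L.val (hb l)
        simp only [map_sub, map_mul, map_sum, map_pow] at h
        rw [hsingle, hsingle] at h
        exact h)
      (fun l => z l ^ Nat.card F ^ (n - 1))
    simp only [horth, mul_zero, Finset.sum_const_zero] at h1
    exact sub_eq_zero.mp h1
  have hj₁ : z j₁ ≠ 0 := by
    intro h0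
    refine hz.ne_zero 0 (pow_eq_zero_iff (n := Nat.card F ^ (n - 1)) ?_ |>.mp ?_)
    · exact pow_ne_zero _ Nat.card_pos.ne'
    · rw [hprop 0, h0, zero_pow (pow_ne_zero _ Nat.card_pos.ne'), mul_zero]
  refine ⟨j₁, hj₁, fun j => ?_⟩
  rw [div_pow, hprop, mul_div_cancel_right₀ _ (pow_ne_zero _ hj₁)]
  exact (u j).2

/-- For a vector `z` that is independent over the subfield `F` of `k` with `q` elements, the
orthogonal `w` of its first Frobenius powers determines a Frobenius power of `z` up to a factor. -/
theorem exists_orthogonal_frobenius (F : Type*) {k K : Type*} [Field F] [Finite F] [Field k]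
    [Field K] [Algebra F k] [Algebra k K] {n : ℕ} {z : Fin (n + 1) → K}
    (hz : ∀ c : Fin (n + 1) → F,
      ∑ j, algebraMap k K (algebraMap F k (c j)) * z j = 0 → c = 0) :
    ∃ (j₀ : Fin (n + 1)) (w : Fin (n + 1) → K),
      (∀ j, ∃ a : Fin n → K, ∀ l, (Pi.single j 1 : Fin (n + 1) → K) l -
        w j * (Pi.single j₀ 1 : Fin (n + 1) → K) l =
          ∑ i, a i * z l ^ Nat.card F ^ (i : ℕ)) ∧
      ∀ L : IntermediateField k K, (∀ j, w j ∈ L) →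
        ∃ j₁, z j₁ ≠ 0 ∧ ∀ j, (z j / z j₁) ^ Nat.card F ^ (n - 1) ∈ L := by
  let _ : Algebra F K := ((algebraMap k K).comp (algebraMap F k)).toAlgebra
  have : IsScalarTower F k K := IsScalarTower.of_algebraMap_eq fun _ => rfl
  have hind : LinearIndependent F z := by
    rw [Fintype.linearIndependent_iff]
    intro c hc
    refine congr_fun (hz c ?_)
    simpa only [Algebra.smul_def, IsScalarTower.algebraMap_apply F k K] using hc
  obtain ⟨j₀, w, hw, hwz⟩ := exists_orthogonal_of_linearIndependent (linearIndependent_moore hind)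
  exact ⟨j₀, w, hw, fun L hL =>
    exists_frobenius_ratio_mem L hind (w := fun j => ⟨w j, hL j⟩) hw hwz⟩

end Moore

/-! ### The Gauss field and pure inseparability. -/

namespace ProjectiveCurve

variable {k : Type*} [Field k] {n : ℕ} {X : ProjectiveCurve k n}

theorem exists_isCoord (X : ProjectiveCurve k n) :
    ∃ (j₀ : Fin (n + 1)) (z : Fin (n + 1) → X.FunField), IsCoord z ∧ coord X.ideal j₀ ≠ 0 ∧
      ∀ i, (z i : X.ConeField) = coord X.ideal i / coord X.ideal j₀ := by
  obtain ⟨-, j₀, hj₀, -⟩ := X.exists_transcendental_ratio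
  exact ⟨j₀, fun i => ⟨_, X.coord_div_coord_mem i j₀⟩,
    ⟨(coord X.ideal j₀)⁻¹, inv_ne_zero hj₀, fun i => div_eq_inv_mul _ _⟩, hj₀, fun _ => rfl⟩

theorem IsCoord.exists_eq_mul {x z : Fin (n + 1) → X.FunField} (hx : IsCoord x) (hz : IsCoord z) :
    ∃ d : X.FunField, ∀ i, z i = d * x i := by
  obtain ⟨-, j, hj, -⟩ := X.exists_transcendental_ratio
  obtain ⟨c, hc, hxc⟩ := hx
  obtain ⟨c', -, hzc⟩ := hz
  refine ⟨z j / x j, fun i => Subtype.ext ?_⟩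
  change (z i : X.ConeField) = (z j : X.ConeField) / (x j : X.ConeField) * (x i : X.ConeField)
  rw [hzc, hzc, hxc, hxc]
  field_simp

theorem IsCoord.eventually_linComb_pow {x z : Fin (n + 1) → X.FunField} (hx : IsCoord x)
    (hz : IsCoord z) {Q : ℕ}
    (h : ∀ᶠ P in X.almostAll, ∀ H, X.IsOsculatingHyperplane P H →
      X.HasValueAt P (linComb (fun j => x j ^ Q) H.rep : X.ConeField) 0) :
    ∀ᶠ P in X.almostAll, ∀ H, X.IsOsculatingHyperplane P H →
      X.HasValueAt P (linComb (fun j => z j ^ Q) H.rep : X.ConeField) 0 := by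
  obtain ⟨d, hd⟩ := hx.exists_eq_mul hz
  filter_upwards [h, X.eventually_regular d] with P hP ⟨c, hc⟩ H hH
  have heq : linComb (fun j => z j ^ Q) H.rep = d ^ Q * linComb (fun j => x j ^ Q) H.rep := by
    simp only [linComb, Finset.mul_sum, hd, mul_pow]
    exact Finset.sum_congr rfl fun j _ => by ring
  rw [heq, MulMemClass.coe_mul]
  simpa using (hc.pow Q).mul (hP H hH)

/-- The function `w` is the pullback of `X_j / X_{j₀}` if its value at almost all points is the
ratio of the corresponding coordinates of the osculating hyperplane. -/
theorem IsOrderSequence.isGaussPullback [IsAlgClosed k] {ε : Fin (n + 1) → ℕ}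
    (hε : X.IsOrderSequence ε) {w : Fin (n + 1) → X.FunField} {j₀ : Fin (n + 1)}
    (hw : ∀ j, ∀ᶠ P in X.almostAll, ∀ H, X.IsOsculatingHyperplane P H →
      ∃ c, X.HasValueAt P (w j : X.ConeField) c ∧ H.rep j = c * H.rep j₀) (j : Fin (n + 1)) :
    X.IsGaussPullback (w j) := by
  refine ⟨1, MvPolynomial.X j, MvPolynomial.X j₀, MvPolynomial.isHomogeneous_X _ _,
    MvPolynomial.isHomogeneous_X _ _, ?_, ?_⟩
  -- All coordinates of `H` are multiples of `H.rep j₀`, so `X_{j₀}` cannot vanish at `H`.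
  · obtain ⟨P, hP, hPε, hPw⟩ :=
      (X.eventually_mem_points.and (hε.eventually.and (eventually_all.mpr hw))).exists
    obtain ⟨H, hH⟩ := hPε.exists_osculatingHyperplane
    refine ⟨H, fun d G _ hG => hG P ⟨hP, ε, hε, hPε⟩ H hH, ?_⟩
    rw [MvPolynomial.eval_X]
    intro h0
    refine H.rep_nonzero (funext fun i => ?_)
    obtain ⟨c, -, hc⟩ := hPw i H hH
    rw [hc, h0, mul_zero]
    rfl
  · refine (X.eventually_almostAll.mp (hw j)).subset ?_
    rintro P ⟨hP, H, hH, h0, hval⟩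
    refine ⟨hP.1, fun h => hval ?_⟩
    obtain ⟨c, hc, hcH⟩ := h H hH
    rw [MvPolynomial.eval_X] at h0
    rw [MvPolynomial.eval_X, MvPolynomial.eval_X, hcH, mul_div_cancel_right₀ _ h0]
    exact hc

/-- Pairing the congruence with `H.rep` and evaluating at `P` kills its right side. Hence `w` takes
the value `H_j / H_{j₀}` whenever `H_{j₀} ≠ 0`. -/
theorem eventually_value_of_orthogonal {Q : Fin n → ℕ} {z : Fin (n + 1) → X.FunField}
    (h : ∀ i, ∀ᶠ P in X.almostAll, ∀ H, X.IsOsculatingHyperplane P H →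
      X.HasValueAt P (linComb (fun j => z j ^ Q i) H.rep : X.ConeField) 0)
    {j j₀ : Fin (n + 1)} {w : X.FunField} {a : Fin n → X.FunField}
    (ha : ∀ l, (Pi.single j 1 : Fin (n + 1) → X.FunField) l -
      w * (Pi.single j₀ 1 : Fin (n + 1) → X.FunField) l = ∑ i, a i * z l ^ Q i) :
    ∀ᶠ P in X.almostAll, ∀ H, X.IsOsculatingHyperplane P H →
      ∃ c, X.HasValueAt P (w : X.ConeField) c ∧ H.rep j = c * H.rep j₀ := by
  have h1 : ∀ᶠ P in X.almostAll, ∀ i, ∃ c, X.HasValueAt P (a i : X.ConeField) c := by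
    simp only [eventually_all]
    exact fun i => X.eventually_regular _
  filter_upwards [X.eventually_mem_points, X.eventually_regular w, h1, eventually_all.mpr h]
    with P hP ⟨c, hc⟩ hPa hPH H hH
  refine ⟨c, hc, ?_⟩
  choose α hα using hPa
  have heq : algebraMap k X.FunField (H.rep j) - w * algebraMap k X.FunField (H.rep j₀) =
      ∑ i, a i * linComb (fun j => z j ^ Q i) H.rep :=
    eq_mul_of_orthogonal ha fun l => algebraMap k X.FunField (H.rep l)
  have hR := HasValueAt.sum (s := Finset.univ) fun i _ => (hα i).mul (hPH i H hH)
  have hL := (HasValueAt.algebraMap (X := X) (P := P) (H.rep j)).sub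
    (hc.mul (HasValueAt.algebraMap (H.rep j₀)))
  have heq' := congrArg (fun y : X.FunField => (y : X.ConeField)) heq
  simp only [AddSubmonoidClass.coe_finsetSum, MulMemClass.coe_mul] at heq'
  rw [← heq'] at hR
  have hval := hL.unique hP hR
  simp only [mul_zero, Finset.sum_const_zero] at hval
  exact sub_eq_zero.mp hval

theorem IsOrderSequence.exists_ratio_pow_mem_gaussField [IsAlgClosed k] {F : Type*} [Field F]
    [Finite F] [Algebra F k] {ε : Fin (n + 1) → ℕ} (hε : X.IsOrderSequence ε)
    {z : Fin (n + 1) → X.FunField} (hz : IsCoord z)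
    (h : ∀ i < n, ∀ᶠ P in X.almostAll, ∀ H, X.IsOsculatingHyperplane P H →
      X.HasValueAt P (linComb (fun j => z j ^ Nat.card F ^ i) H.rep : X.ConeField) 0) :
    ∃ j₁, z j₁ ≠ 0 ∧ ∀ j, (z j / z j₁) ^ Nat.card F ^ (n - 1) ∈ X.gaussField := by
  obtain ⟨j₀, w, hw, hL⟩ := exists_orthogonal_frobenius F (k := k) (z := z) fun c hc =>
    funext fun j => by simpa using congr_fun (hε.linComb_injective hz hc) j
  refine hL X.gaussField fun j => subset_adjoin _ _ (hε.isGaussPullback (j₀ := j₀) (fun j => ?_) j)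
  obtain ⟨a, ha⟩ := hw j
  exact eventually_value_of_orthogonal (fun i => h i i.2) ha

/-- Raising to the power `p ^ r` is a ring homomorphism, so membership in `L` need only be checked
on the ratios of coordinates, which generate the function field. -/
theorem isPurelyInseparable_of_ratio_pow_mem {p : ℕ} [ExpChar k p] {r : ℕ}
    (L : IntermediateField k X.FunField) {j₀ : Fin (n + 1)} {z : Fin (n + 1) → X.FunField}
    (hj₀ : coord X.ideal j₀ ≠ 0)
    (hz : ∀ i, (z i : X.ConeField) = coord X.ideal i / coord X.ideal j₀) {j₁ : Fin (n + 1)}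
    (hj₁ : z j₁ ≠ 0) (h : ∀ j, (z j / z j₁) ^ p ^ r ∈ L) :
    IsPurelyInseparable L X.FunField := by
  have : ExpChar X.FunField p :=
    expChar_of_injective_algebraMap (algebraMap k X.FunField).injective p
  have : ExpChar L p := expChar_of_injective_algebraMap (algebraMap k L).injective p
  have hmem : ∀ (φ : X.ConeField) (hφ : φ ∈ functionField X.ideal),
      (⟨φ, hφ⟩ : X.FunField) ^ p ^ r ∈ L := by
    intro φ hφ
    induction hφ using IntermediateField.adjoin_induction with
    | mem φ hφ =>
      obtain ⟨i, j, rfl⟩ := hφ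
      have heq : (⟨coord X.ideal i / coord X.ideal j, X.coord_div_coord_mem i j⟩ : X.FunField) =
          (z i / z j₁) / (z j / z j₁) := by
        rw [div_div_div_cancel_right₀ hj₁]
        refine Subtype.ext ?_
        change _ = (z i : X.ConeField) / (z j : X.ConeField)
        rw [hz, hz, div_div_div_cancel_right₀ hj₀]
      rw [heq, div_pow]
      exact div_mem (h i) (h j)
    | algebraMap a => exact pow_mem (L.algebraMap_mem a) _
    | add φ ψ hφ' hψ' hφ hψ =>
      have := add_mem hφ hψ
      rwa [← add_pow_expChar_pow] at this
    | mul φ ψ hφ' hψ' hφ hψ =>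
      have := mul_mem hφ hψ
      rwa [← mul_pow] at this
    | inv φ hφ' hφ =>
      have := inv_mem hφ
      rwa [← inv_pow] at this
  rw [isPurelyInseparable_iff_pow_mem L p]
  exact fun φ => ⟨r, ⟨_, hmem φ φ.2⟩, rfl⟩

end ProjectiveCurve

end ArakelianGauss

end

open ArakelianGauss ArakelianGauss.ProjectiveCurve

theorem mainTheorem2 {F k : Type*} [Field F] [Finite F] [Field k] [Algebra F k] [IsAlgClosure F k]
    {n : ℕ} (X : ArakelianGauss.ProjectiveCurve k n) (hX : X.IsDefinedOver F)
    (ε : Fin (n + 1) → ℕ) (hε : X.IsOrderSequence ε)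
    (hν : ∀ (i : ℕ) (h₁ : 1 ≤ i) (h₂ : i ≤ n - 1),
      ∃ ν : Fin n → ℕ, X.IsFrobeniusOrderSequence F (Nat.card F ^ i) ν ∧
        ν ≠ (fun l : Fin n => (l : ℕ)) ∧ ν ⟨n - 1, by omega⟩ = ε (Fin.last n)) :
    X.gaussSepDegree = 1 ∧ IsPurelyInseparable X.gaussField X.FunField := by
  have : IsAlgClosed k := IsAlgClosure.isAlgClosed F
  suffices h : IsPurelyInseparable X.gaussField X.FunField from
    ⟨IsPurelyInseparable.finSepDegree_eq_one _ _, h⟩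
  obtain ⟨j₀, z, hz, hj₀, hzj⟩ := X.exists_isCoord
  have hosc : ∀ i < n, ∀ᶠ P in X.almostAll, ∀ H, X.IsOsculatingHyperplane P H →
      X.HasValueAt P (linComb (fun j => z j ^ Nat.card F ^ i) H.rep : X.ConeField) 0 := by
    intro i hi
    rcases Nat.eq_zero_or_pos i with rfl | hi0
    -- The exponent `q ^ 0` needs no Frobenius hypothesis: it says that `H_P` passes through `P`.
    · simpa using hε.eventually_value_osculating_zero hz (by omega)
    · obtain ⟨ν, ⟨x, t, ht, hx, hleast⟩, -, hlast⟩ := hν i hi0 (by omega)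
      obtain ⟨n, rfl⟩ : ∃ m, n = m + 1 := ⟨n - 1, by omega⟩
      have hx : IsCoord x := hx.2
      exact hx.eventually_linComb_pow hz (hε.eventually_frobenius hx ht hleast hlast)
  obtain ⟨j₁, hj₁, hmem⟩ := hε.exists_ratio_pow_mem_gaussField hz hosc
  let _ := Fintype.ofFinite F
  obtain ⟨p, hp, r, hp', hr⟩ := FiniteField.card' F
  have : ExpChar F p := ExpChar.prime hp'
  have : ExpChar k p := expChar_of_injective_algebraMap (algebraMap F k).injective p
  rw [Nat.card_eq_fintype_card, hr, ← pow_mul] at hmem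
  exact isPurelyInseparable_of_ratio_pow_mem X.gaussField hj₀ hzj hj₁ hmem
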